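/- For integers $1\le M<N$, a set $\Theta\subset\{1,\dots,N\}$ with $|\Theta|=M$, and vectors $b=(b_0,\dots,b_{N-1})$ and $c=(c_{-N+1},\dots,c_{N-1})$, let $\Phi_\Theta(b),T_\Theta(c)\in\mathbb R^{M\times N}$ consist of the rows with index in $\Theta$ of the circulant matrix $\Phi(b)=(b_{(j-k)\bmod N})_{k,j=1}^N$ and of the Toeplitz matrix $T(c)=(c_{j-k})_{k,j=1}^N$, respectively. Let $\mathbb 1$ be the $M\times N$ matrix with all entries equal to one. For a real random variable $X$ put $\|X\|_{\Psi_2}=\sup_{p\ge1}p^{-1/2}(\mathbb E|X|^p)^{1/p}$. For $A\in\mathbb R^{M\times N}$ and $y\in\mathbb R^M$ consider box-constrained basis pursuit $$\text{(P)}\quad \min\|x\|_1\ \text{ subject to } Ax=y,\ x\in[0,1]^N,$$ and box-constrained least squares $$\text{(LS)}\quad \min\|Ax-y\|_2\ \text{ subject to } x\in[0,1]^N.$$ **Theorem.** There is an absolute constant $C'>0$, and for all $\mu>0$ and $\sigma>0$ there is a constant $C>0$ depending only on $\mu$ and $\sigma$, such that the following holds. Let $1\le M<N$, let $\Theta\subset\{1,\dots,N\}$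 with $|\Theta|=M$, let $\varepsilon>0$, and let $x_0\in\{0,1\}^N$ have exactly $s$ non-zero entries. Let the random matrix $A\in\mathbb R^{M\times N}$ be either (i) $A=\mu\mathbb 1+\Phi_\Theta(b)$, or (ii) $A=\mu\mathbb 1+T_\Theta(c)$, where the entries of the random vector $b$ (respectively $c$) are independent, have mean $0$ and variance $\sigma^2$, and the maximum of their $\Psi_2$-norms is $R<\infty$. Suppose that $$M\ \ge\ C\,\max\Big(\frac{R^2}{\mu^2},\ \min(s,N-s)\,\frac{2R^4}{\sigma^4}\Big)\log\Big(\frac N\varepsilon\Big).$$ Then, with probability larger than $1-\varepsilon$, $x_0$ is the unique solution of (P) and the unique solution of (LS) for $y=Ax_0$. (iii) If in addition $M\ge C'\,(R/\sigma)^{4/3}\log(\varepsilon^{-1})$, then with probability larger than $1-\varepsilon$ the following holds besides: for all $\eta>0$, all $n\in\mathbb R^M$ with $\|n\|_2\le\eta$ and every solution $x_*$ of (LS) for $y=Ax_0+n$, $$\|x_0-x_*\|_2\ \le\ \sqrt{\frac{9\left(\frac{16\sigma^2}{\mu^2}+\min(s,N-s)\right)}{M\sigma^2}}\;\eta .$$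 -/

import Mathlib

open MeasureTheory ProbabilityTheory
open scoped ENNReal Matrix

noncomputable section

namespace BinaryRecovery

/-- The sub-Gaussian (Orlicz-2) norm `sup_{p ≥ 1} p^{-1/2} (E |X|^p)^{1/p}`, with values in `[0, ∞]`. -/
def subGaussianNorm {Ω : Type*} [MeasurableSpace Ω] (P : Measure Ω) (X : Ω → ℝ) : ℝ≥0∞ :=
  ⨆ (p : ℝ) (_ : 1 ≤ p), ENNReal.ofReal (p ^ (-(1 / 2) : ℝ)) * eLpNorm X (ENNReal.ofReal p) P

/-- A random vector whose entries are independent, centred, of second moment `σ ^ 2`, and whose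
sub-Gaussian norm (the largest sub-Gaussian norm of an entry) is the real number `R`. -/
structure IsSubGaussianVector {Ω : Type*} [MeasurableSpace Ω] (P : Measure Ω) {ι : Type*}
    (σ R : ℝ) (X : ι → Ω → ℝ) : Prop where
  measurable : ∀ i, Measurable (X i)
  indep : iIndepFun X P
  mean_eq_zero : ∀ i, ∫ ω, X i ω ∂P = 0
  second_moment : ∀ i, ∫ ω, X i ω ^ 2 ∂P = σ ^ 2
  norm_eq : ⨆ i, subGaussianNorm P (X i) = ENNReal.ofReal R

/-- The circulant matrix `Φ(b)` with entries `Φ_{k,j} = b_{j - k mod N}`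
(subtraction in `Fin N` is modulo `N`). -/
def circulantMatrix {N : ℕ} (b : Fin N → ℝ) : Matrix (Fin N) (Fin N) ℝ :=
  Matrix.of fun k j => b (j - k)

/-- The Toeplitz matrix `T(c)` with entries `T_{k,j} = c_{j - k}`, where
`c = (c_{-N+1}, …, c_{N-1})`. -/
def toeplitzMatrix {N : ℕ} (c : Set.Ioo (-(N : ℤ)) (N : ℤ) → ℝ) : Matrix (Fin N) (Fin N) ℝ :=
  Matrix.of fun k j => c ⟨(j : ℤ) - (k : ℤ), by
    have hj := j.isLt
    have hk := k.isLt
    constructor <;> omega⟩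

/-- The submatrix of the rows indexed by `Θ`. -/
def rowsOf {N : ℕ} (B : Matrix (Fin N) (Fin N) ℝ) (Θ : Finset (Fin N)) : Matrix Θ (Fin N) ℝ :=
  B.submatrix (fun k : Θ => (k : Fin N)) id

/-- The biased matrix `μ 𝟙 + D`, where `𝟙` has all entries equal to one. -/
def biased {m n : Type*} (μ : ℝ) (D : Matrix m n ℝ) : Matrix m n ℝ :=
  μ • (Matrix.of fun _ _ => 1) + D

/-- The Euclidean norm of a real vector. -/
def l2norm {ι : Type*} [Fintype ι] (x : ι → ℝ) : ℝ := Real.sqrt (∑ i, x i ^ 2)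

/-- The `ℓ_1`-norm of a real vector. -/
def l1norm {ι : Type*} [Fintype ι] (x : ι → ℝ) : ℝ := ∑ i, |x i|

/-- The cube `[0,1]^n`. -/
def box (n : Type*) : Set (n → ℝ) := {x | ∀ i, x i ∈ Set.Icc (0 : ℝ) 1}

variable {m n : Type*} [Fintype m] [Fintype n]

/-- The solutions of box-constrained basis pursuit:
`min ‖x‖₁` subject to `A x = y` and `x ∈ [0,1]^n`. -/
def boxBasisPursuit (A : Matrix m n ℝ) (y : m → ℝ) : Set (n → ℝ) :=
  {x | (A *ᵥ x = y ∧ x ∈ box n) ∧ ∀ z, A *ᵥ z = y → z ∈ box n → l1norm x ≤ l1norm z}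

/-- The solutions of box-constrained least squares:
`min ‖A x - y‖₂` subject to `x ∈ [0,1]^n`. -/
def boxLeastSquares (A : Matrix m n ℝ) (y : m → ℝ) : Set (n → ℝ) :=
  {x | x ∈ box n ∧ ∀ z ∈ box n, l2norm (A *ᵥ x - y) ≤ l2norm (A *ᵥ z - y)}

/-- From `y = A x₀`, the vector `x₀` is the unique solution of box-constrained basis pursuit and
also the unique solution of box-constrained least squares. -/
def ExactRecovery (A : Matrix m n ℝ) (x₀ : n → ℝ) : Prop :=
  boxBasisPursuit A (A *ᵥ x₀) = {x₀} ∧ boxLeastSquares A (A *ᵥ x₀) = {x₀}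

/-- For every noise level `η > 0` and every noise vector `e` with `‖e‖₂ ≤ η`, each solution `x` of
box-constrained least squares for `y = A x₀ + e` satisfies `‖x₀ - x‖₂ ≤ K η`. -/
def RobustRecovery (A : Matrix m n ℝ) (x₀ : n → ℝ) (K : ℝ) : Prop :=
  ∀ η : ℝ, 0 < η → ∀ e : m → ℝ, l2norm e ≤ η →
    ∀ x ∈ boxLeastSquares A (A *ᵥ x₀ + e), l2norm (x₀ - x) ≤ K * η

end BinaryRecovery

end

noncomputable section

namespace BinaryRecovery

/-! ### Deterministic part: dual certificates and a cone estimate. -/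

section Deterministic

variable {m n : Type*} [Fintype m] [Fintype n]

/-! For x in the box, h = x - x₀ is nonpositive where x₀ = 1 and nonnegative where x₀ = 0. A lower
bound for A on this cone gives uniqueness and stability at once (`recovery_of_cone_bound`). It
follows from two vectors with v₂ᵀA ≈ χ_T and v₁ᵀA ≈ χ_{Tᶜ}: pairing them with A h controls the
ℓ₁-masses of h on and off T.

Write A = μ𝟙 + D. Centring Dχ_T and dividing by Mσ² gives v₂: it does not see the bias, and v₂ᵀD ≈
DᵀDχ_T/(Mσ²). Since the constant vector 1/(μM) is mapped to nearly the all-ones vector, subtracting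
v₂ from it gives v₁. So `cone_bound_of_gram` needs only small column sums of D and DᵀDχ_T ≈ Mσ²χ_T
entrywise. As T is fixed, a union bound over the N columns suffices.

Column sums are linear in independent variables. A Gram entry is a centred sum of squares plus an
off-diagonal quadratic form, for which a Hanson-Wright bound is proved by decoupling and Gaussian
linearisation (`lintegral_exp_quadratic_le`). Circulant and Toeplitz matrices are treated together:
all that matters is that no variable repeats within a row or a column. This makes the coefficient
matrix have entries in [0,1], zero diagonal, row and column sums at most |T| and squared Frobenius
norm at most M|T|. Finally T may be the support or the zero set of x₀, because h and -h are
interchangeable; hence min(s, N - s). -/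

lemma l2norm_nonneg (x : m → ℝ) : 0 ≤ l2norm x := Real.sqrt_nonneg _

lemma l2norm_sq (x : m → ℝ) : l2norm x ^ 2 = ∑ i, x i ^ 2 :=
  Real.sq_sqrt (Finset.sum_nonneg fun _ _ => sq_nonneg _)

lemma l2norm_eq_norm (x : m → ℝ) : l2norm x = ‖WithLp.toLp 2 x‖ := by
  simp [l2norm, EuclideanSpace.norm_eq]

lemma l2norm_sub_le (x y : m → ℝ) : l2norm (x - y) ≤ l2norm x + l2norm y := by
  simp only [l2norm_eq_norm, WithLp.toLp_sub]
  exact norm_sub_le _ _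

lemma l2norm_sub_comm (x y : m → ℝ) : l2norm (x - y) = l2norm (y - x) := by
  simp only [l2norm_eq_norm, WithLp.toLp_sub]
  exact norm_sub_rev _ _

lemma l2norm_zero : l2norm (0 : m → ℝ) = 0 := by simp [l2norm]

lemma eq_zero_of_l2norm_le_zero {x : m → ℝ} (h : l2norm x ≤ 0) : x = 0 := by
  have h0 : l2norm x = 0 := le_antisymm h (l2norm_nonneg x)
  rw [l2norm_eq_norm, norm_eq_zero] at h0
  exact (WithLp.toLp_eq_zero 2).1 h0

lemma abs_dotProduct_le (x y : m → ℝ) : |x ⬝ᵥ y| ≤ l2norm x * l2norm y := by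
  apply abs_le_of_sq_le_sq _ (mul_nonneg (l2norm_nonneg _) (l2norm_nonneg _))
  rw [mul_pow, l2norm_sq, l2norm_sq]
  exact Finset.sum_mul_sq_le_sq_mul_sq _ _ _

/-- A pair of approximate dual certificates for the sign pattern of a cone of differences
controls the differences by their images. -/
theorem l2norm_sq_le_of_certificates [DecidableEq n] (A : Matrix m n ℝ) (T : Finset n)
    (v₁ v₂ : m → ℝ) {δ : ℝ} (hδ0 : 0 ≤ δ) (hδ : δ < 1 / 2)
    (h₁ : ∀ j, |(v₁ ᵥ* A) j - (if j ∈ T then 0 else 1)| ≤ δ)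
    (h₂ : ∀ j, |(v₂ ᵥ* A) j - (if j ∈ T then 1 else 0)| ≤ δ)
    {h : n → ℝ} (hT : ∀ j ∈ T, h j ≤ 0) (hTc : ∀ j ∉ T, 0 ≤ h j) :
    (1 - 2 * δ) ^ 2 * l2norm h ^ 2 ≤
      (l2norm v₁ ^ 2 + l2norm v₂ ^ 2) * l2norm (A *ᵥ h) ^ 2 := by
  -- p and q are the ℓ₁-masses of h off T and on T; each dominates the ℓ₂-norm of its part.
  set p := ∑ j, if j ∈ T then 0 else h j with hp
  set q := ∑ j, if j ∈ T then -h j else 0 with hq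
  have hp0 : 0 ≤ p := Finset.sum_nonneg fun j _ => by split_ifs with hj; exacts [le_rfl, hTc j hj]
  have hq0 : 0 ≤ q := Finset.sum_nonneg fun j _ => by
    split_ifs with hj; exacts [neg_nonneg.2 (hT j hj), le_rfl]
  have hnorm : l2norm h ^ 2 ≤ p ^ 2 + q ^ 2 := by
    have e : l2norm h ^ 2 = ∑ j, (if j ∈ T then 0 else h j) ^ 2
        + ∑ j, (if j ∈ T then -h j else 0) ^ 2 := by
      rw [l2norm_sq, ← Finset.sum_add_distrib]
      refine Finset.sum_congr rfl fun j _ => ?_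
      split_ifs <;> ring
    rw [e]
    refine add_le_add (Finset.sum_sq_le_sq_sum_of_nonneg fun j _ => ?_)
      (Finset.sum_sq_le_sq_sum_of_nonneg fun j _ => ?_)
    · split_ifs with hj; exacts [le_rfl, hTc j hj]
    · split_ifs with hj; exacts [neg_nonneg.2 (hT j hj), le_rfl]
  have hP : (1 - δ) * p - δ * q ≤ l2norm v₁ * l2norm (A *ᵥ h) := by
    refine le_trans ?_ ((le_abs_self _).trans (abs_dotProduct_le v₁ (A *ᵥ h)))
    rw [Matrix.dotProduct_mulVec, hp, hq, Finset.mul_sum, Finset.mul_sum,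
      ← Finset.sum_sub_distrib]
    refine Finset.sum_le_sum fun j _ => ?_
    have := abs_le.1 (h₁ j)
    split_ifs at this ⊢ with hj
    · nlinarith [hT j hj]
    · nlinarith [hTc j hj]
  have hQ : (1 - δ) * q - δ * p ≤ l2norm v₂ * l2norm (A *ᵥ h) := by
    refine le_trans ?_ ((neg_le_abs _).trans (abs_dotProduct_le v₂ (A *ᵥ h)))
    rw [Matrix.dotProduct_mulVec, hp, hq, Finset.mul_sum, Finset.mul_sum,
      ← Finset.sum_sub_distrib, dotProduct, ← Finset.sum_neg_distrib]
    refine Finset.sum_le_sum fun j _ => ?_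
    have := abs_le.1 (h₂ j)
    split_ifs at this ⊢ with hj
    · nlinarith [hT j hj]
    · nlinarith [hTc j hj]
  have ha := l2norm_nonneg (A *ᵥ h)
  have hV₁ := mul_nonneg (l2norm_nonneg v₁) ha
  have hV₂ := mul_nonneg (l2norm_nonneg v₂) ha
  have hR : (l2norm v₁ ^ 2 + l2norm v₂ ^ 2) * l2norm (A *ᵥ h) ^ 2 =
      (l2norm v₁ * l2norm (A *ᵥ h)) ^ 2 + (l2norm v₂ * l2norm (A *ᵥ h)) ^ 2 := by ring
  rw [hR]
  generalize l2norm v₁ * l2norm (A *ᵥ h) = V₁ at *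
  generalize l2norm v₂ * l2norm (A *ᵥ h) = V₂ at *
  -- Inverts the 2×2 system with rows (1-δ, -δ) and (-δ, 1-δ), of determinant 1 - 2δ.
  have hp' : (1 - 2 * δ) * p ≤ (1 - δ) * V₁ + δ * V₂ := by nlinarith
  have hq' : (1 - 2 * δ) * q ≤ (1 - δ) * V₂ + δ * V₁ := by nlinarith
  have hd : 0 ≤ 1 - 2 * δ := by linarith
  have h1 : ((1 - 2 * δ) * p) ^ 2 ≤ ((1 - δ) * V₁ + δ * V₂) ^ 2 :=
    pow_le_pow_left₀ (mul_nonneg hd hp0) hp' 2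
  have h2 : ((1 - 2 * δ) * q) ^ 2 ≤ ((1 - δ) * V₂ + δ * V₁) ^ 2 :=
    pow_le_pow_left₀ (mul_nonneg hd hq0) hq' 2
  have h3 : (1 - 2 * δ) ^ 2 * l2norm h ^ 2 ≤ (1 - 2 * δ) ^ 2 * (p ^ 2 + q ^ 2) :=
    mul_le_mul_of_nonneg_left hnorm (sq_nonneg _)
  -- This is exactly the loss when V₁, V₂ are replaced by their two convex combinations in the sum
  -- of squares.
  have h4 : 0 ≤ 2 * (1 - δ) * δ * (V₁ - V₂) ^ 2 := by
    have : 0 ≤ 1 - δ := by linarith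
    positivity
  nlinarith

/-- The cone estimate for the differences with a binary vector gives exact and robust recovery. -/
theorem recovery_of_cone_bound (A : Matrix m n ℝ) {x₀ : n → ℝ} (hx₀ : ∀ i, x₀ i = 0 ∨ x₀ i = 1)
    {K : ℝ} (hK0 : 0 ≤ K)
    (hK : ∀ h : n → ℝ, (∀ j, x₀ j = 1 → h j ≤ 0) → (∀ j, x₀ j = 0 → 0 ≤ h j) →
      2 * l2norm h ≤ K * l2norm (A *ᵥ h)) :
    ExactRecovery A x₀ ∧ RobustRecovery A x₀ K := by
  have hbox₀ : x₀ ∈ box n := fun i => by rcases hx₀ i with h | h <;> simp [h]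
  have key : ∀ x ∈ box n, 2 * l2norm (x - x₀) ≤ K * l2norm (A *ᵥ x - A *ᵥ x₀) := by
    intro x hx
    rw [← Matrix.mulVec_sub]
    refine hK _ (fun j hj => ?_) (fun j hj => ?_)
    · simpa [hj] using (hx j).2
    · simpa [hj] using (hx j).1
  have uniq : ∀ x ∈ box n, A *ᵥ x = A *ᵥ x₀ → x = x₀ := by
    intro x hx hA
    have := key x hx
    rw [hA, sub_self, l2norm_zero, mul_zero] at this
    exact sub_eq_zero.1 (eq_zero_of_l2norm_le_zero (by linarith))
  refine ⟨⟨?_, ?_⟩, ?_⟩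
  · ext x
    simp only [boxBasisPursuit, Set.mem_ofPred_eq, Set.mem_singleton_iff]
    refine ⟨fun h => uniq x h.1.2 h.1.1, ?_⟩
    rintro rfl
    exact ⟨⟨rfl, hbox₀⟩, fun z hz hb => by rw [uniq z hb hz]⟩
  · ext x
    simp only [boxLeastSquares, Set.mem_ofPred_eq, Set.mem_singleton_iff]
    constructor
    · rintro ⟨hx, h⟩
      have := h x₀ hbox₀
      rw [sub_self, l2norm_zero] at this
      exact uniq x hx (sub_eq_zero.1 (eq_zero_of_l2norm_le_zero this))
    · rintro rfl
      refine ⟨hbox₀, fun z _ => ?_⟩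
      rw [sub_self, l2norm_zero]
      exact l2norm_nonneg _
  · rintro η - e he x ⟨hx, hmin⟩
    have h1 : l2norm (A *ᵥ x - (A *ᵥ x₀ + e)) ≤ η := by
      refine (hmin x₀ hbox₀).trans ?_
      rw [show A *ᵥ x₀ - (A *ᵥ x₀ + e) = 0 - e by abel]
      refine (l2norm_sub_le _ _).trans ?_
      rw [l2norm_zero, zero_add]
      exact he
    -- The noise counts twice, once in y and once through minimality; the factor 2 in `hK` absorbs
    -- this.
    have h2 : l2norm (A *ᵥ x₀ - A *ᵥ x) ≤ 2 * η := by
      rw [show A *ᵥ x₀ - A *ᵥ x = ((0 : m → ℝ) - e) - (A *ᵥ x - (A *ᵥ x₀ + e)) by abel]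
      have h3 := l2norm_sub_le ((0 : m → ℝ) - e) (A *ᵥ x - (A *ᵥ x₀ + e))
      have h4 := l2norm_sub_le (0 : m → ℝ) e
      rw [l2norm_zero] at h4
      linarith
    have h3 := key x hx
    rw [l2norm_sub_comm x, l2norm_sub_comm (A *ᵥ x)] at h3
    nlinarith
end Deterministic

/-! ### From the sub-Gaussian norm to exponential moments. -/

section Moments

/-- Compare power series termwise: from degree 2 on, |s|^k ≤ s². Integrating kills the linear term
of a centred variable and leaves only order s². -/
lemma exp_mul_le_quadratic {s : ℝ} (hs : |s| ≤ 1) (z : ℝ) :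
    Real.exp (s * z) ≤ 1 + s * z + s ^ 2 * Real.exp |z| := by
  have hexp : ∀ x : ℝ, HasSum (fun k : ℕ => x ^ k / (k.factorial : ℝ)) (Real.exp x) := by
    intro x
    rw [Real.exp_eq_exp_ℝ]
    exact NormedSpace.expSeries_div_hasSum_exp x
  have h0 : HasSum (fun k : ℕ => if k = 0 then (1 : ℝ) else 0) 1 := by
    simpa using hasSum_ite_eq (0 : ℕ) (1 : ℝ)
  have h1 : HasSum (fun k : ℕ => if k = 1 then s * z else 0) (s * z) := by
    simpa using hasSum_ite_eq (1 : ℕ) (s * z)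
  refine hasSum_le (fun k => ?_) (hexp (s * z)) ((h0.add h1).add ((hexp |z|).mul_left (s ^ 2)))
  rcases k with _ | _ | k
  · simpa using sq_nonneg s
  · simp; positivity
  · have hle : (s * z) ^ (k + 2) ≤ s ^ 2 * |z| ^ (k + 2) := by
      refine (le_abs_self _).trans ?_
      rw [abs_pow, abs_mul, mul_pow]
      refine mul_le_mul_of_nonneg_right ?_ (by positivity)
      rw [← sq_abs s]
      exact pow_le_pow_of_le_one (abs_nonneg _) hs (by omega)
    rw [if_neg (by omega), if_neg (by omega), add_zero, zero_add, ← mul_div_assoc]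
    exact div_le_div_of_nonneg_right hle (Nat.cast_nonneg _)

variable {Ω : Type*} [MeasurableSpace Ω] {P : Measure Ω}

lemma integrable_of_lintegral_ofReal_le {f : Ω → ℝ} {K : ℝ} (hf : Measurable f)
    (hf0 : ∀ ω, 0 ≤ f ω) (h : ∫⁻ ω, ENNReal.ofReal (f ω) ∂P ≤ ENNReal.ofReal K) :
    Integrable f P := by
  refine ⟨hf.aestronglyMeasurable, ?_⟩
  rw [hasFiniteIntegral_iff_ofReal (Filter.Eventually.of_forall hf0)]
  exact h.trans_lt ENNReal.ofReal_lt_top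

/-- A centred random variable with an exponential moment has a sub-Gaussian moment generating
function near the origin. -/
theorem lintegral_exp_mul_le_of_centered [IsProbabilityMeasure P] {Z : Ω → ℝ} {K : ℝ}
    (hZ : Measurable Z) (hK0 : 0 ≤ K) (h0 : ∫ ω, Z ω ∂P = 0)
    (hK : ∫⁻ ω, ENNReal.ofReal (Real.exp |Z ω|) ∂P ≤ ENNReal.ofReal K) {s : ℝ} (hs : |s| ≤ 1) :
    ∫⁻ ω, ENNReal.ofReal (Real.exp (s * Z ω)) ∂P ≤ ENNReal.ofReal (Real.exp (K * s ^ 2)) := by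
  have hE : Integrable (fun ω => Real.exp |Z ω|) P :=
    integrable_of_lintegral_ofReal_le (by fun_prop) (fun _ => (Real.exp_pos _).le) hK
  have hZi : Integrable Z P := by
    refine hE.mono' hZ.aestronglyMeasurable (Filter.Eventually.of_forall fun ω => ?_)
    rw [Real.norm_eq_abs]
    linarith [Real.add_one_le_exp |Z ω|]
  have hsZ : Integrable (fun ω => Real.exp (s * Z ω)) P := by
    refine hE.mono' (by fun_prop) (Filter.Eventually.of_forall fun ω => ?_)
    rw [Real.norm_eq_abs, abs_of_pos (Real.exp_pos _)]
    refine Real.exp_le_exp.2 ((le_abs_self _).trans ?_)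
    rw [abs_mul]
    exact mul_le_of_le_one_left (abs_nonneg _) hs
  have hKE : ∫ ω, Real.exp |Z ω| ∂P ≤ K := by
    rw [integral_eq_lintegral_of_nonneg_ae
      (Filter.Eventually.of_forall fun _ => (Real.exp_pos _).le) hE.aestronglyMeasurable]
    exact ENNReal.toReal_le_of_le_ofReal hK0 hK
  rw [← ofReal_integral_eq_lintegral_ofReal hsZ
    (Filter.Eventually.of_forall fun _ => (Real.exp_pos _).le)]
  refine ENNReal.ofReal_le_ofReal ?_
  calc ∫ ω, Real.exp (s * Z ω) ∂P
      ≤ ∫ ω, (1 + s * Z ω + s ^ 2 * Real.exp |Z ω|) ∂P :=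
        integral_mono hsZ (((integrable_const _).add (hZi.const_mul _)).add (hE.const_mul _))
          fun ω => exp_mul_le_quadratic hs _
    _ = 1 + s ^ 2 * ∫ ω, Real.exp |Z ω| ∂P := by
        rw [integral_add (f := fun ω => 1 + s * Z ω) ((integrable_const _).add (hZi.const_mul _))
          (hE.const_mul _), integral_add (integrable_const _) (hZi.const_mul _),
          integral_const_mul, integral_const_mul, h0]
        simp
    _ ≤ K * s ^ 2 + 1 := by nlinarith [sq_nonneg s]
    _ ≤ Real.exp (K * s ^ 2) := Real.add_one_le_exp _

variable {X : Ω → ℝ} {R σ : ℝ}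

/-- The even moments of a sub-Gaussian random variable. -/
lemma lintegral_pow_le_of_subGaussianNorm_le (hR : 0 ≤ R)
    (h : subGaussianNorm P X ≤ ENNReal.ofReal R) {k : ℕ} (hk : k ≠ 0) :
    ∫⁻ ω, ENNReal.ofReal (X ω ^ (2 * k)) ∂P ≤ ENNReal.ofReal ((2 * k * R ^ 2) ^ k) := by
  have hk1 : (1 : ℝ) ≤ k := by exact_mod_cast Nat.one_le_iff_ne_zero.2 hk
  have hp : (0 : ℝ) < 2 * k := by linarith
  have h1 := (le_iSup₂ (f := fun (p : ℝ) (_ : 1 ≤ p) => ENNReal.ofReal (p ^ (-(1 / 2) : ℝ)) *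
    eLpNorm X (ENNReal.ofReal p) P) (2 * k : ℝ) (by linarith)).trans h
  have hsq : 0 < Real.sqrt (2 * k) := Real.sqrt_pos.2 hp
  rw [Real.rpow_neg hp.le, ← Real.sqrt_eq_rpow, ENNReal.ofReal_inv_of_pos hsq,
    ENNReal.inv_mul_le_iff (by simpa using hsq) ENNReal.ofReal_ne_top,
    ← ENNReal.ofReal_mul hsq.le,
    eLpNorm_eq_lintegral_rpow_enorm_toReal (ENNReal.ofReal_pos.2 hp).ne' ENNReal.ofReal_ne_top,
    ENNReal.toReal_ofReal hp.le, one_div, ENNReal.rpow_inv_le_iff hp,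
    ENNReal.ofReal_rpow_of_nonneg (by positivity) hp.le] at h1
  calc ∫⁻ ω, ENNReal.ofReal (X ω ^ (2 * k)) ∂P = ∫⁻ ω, ‖X ω‖ₑ ^ (2 * k : ℝ) ∂P := by
        refine lintegral_congr fun ω => ?_
        rw [← Even.pow_abs (even_two_mul k), Real.enorm_eq_ofReal_abs,
          ENNReal.ofReal_rpow_of_nonneg (abs_nonneg _) hp.le]
        congr 1
        exact_mod_cast (Real.rpow_natCast |X ω| (2 * k)).symm
    _ ≤ _ := h1
    _ = _ := by
        congr 1
        rw [show (2 * k : ℝ) = ((2 * k : ℕ) : ℝ) by push_cast; ring, Real.rpow_natCast, pow_mul,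
          mul_pow, Real.sq_sqrt (by positivity)]

/-- A sub-Gaussian random variable has a square-exponential moment. -/
theorem lintegral_exp_sq_le [IsProbabilityMeasure P] (hX : Measurable X) (hR : 0 < R)
    (h : subGaussianNorm P X ≤ ENNReal.ofReal R) :
    ∫⁻ ω, ENNReal.ofReal (Real.exp (X ω ^ 2 / (12 * R ^ 2))) ∂P ≤ 2 := by
  have hexp : ∀ x : ℝ, HasSum (fun k : ℕ => x ^ k / (k.factorial : ℝ)) (Real.exp x) := by
    intro x
    rw [Real.exp_eq_exp_ℝ]
    exact NormedSpace.expSeries_div_hasSum_exp x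
  have e1 : ∀ ω, ENNReal.ofReal (Real.exp (X ω ^ 2 / (12 * R ^ 2))) =
      ∑' k : ℕ, ENNReal.ofReal ((12 * R ^ 2)⁻¹ ^ k / k.factorial) *
        ENNReal.ofReal (X ω ^ (2 * k)) := by
    intro ω
    rw [← (hexp _).tsum_eq, ENNReal.ofReal_tsum_of_nonneg (fun k => by positivity)
      (hexp _).summable]
    refine tsum_congr fun k => ?_
    rw [← ENNReal.ofReal_mul (by positivity)]
    congr 1
    rw [div_pow, pow_mul, inv_pow]
    field_simp
  -- As k^k/k! ≤ e^k ≤ 3^k, the moments over k! are at most (6R²)^k; the constant 12 makes the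
  -- series geometric of ratio 1/2.
  have e2 : ∀ k : ℕ, ENNReal.ofReal ((12 * R ^ 2)⁻¹ ^ k / k.factorial) *
      ∫⁻ ω, ENNReal.ofReal (X ω ^ (2 * k)) ∂P ≤ 2⁻¹ ^ k := by
    intro k
    rcases eq_or_ne k 0 with rfl | hk
    · simp
    refine (mul_le_mul_right (lintegral_pow_le_of_subGaussianNorm_le hR.le h hk) _).trans ?_
    rw [← ENNReal.ofReal_mul (by positivity),
      show (2⁻¹ : ℝ≥0∞) = ENNReal.ofReal (1 / 2) by
        rw [one_div, ENNReal.ofReal_inv_of_pos two_pos]; simp,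
      ← ENNReal.ofReal_pow (by norm_num)]
    refine ENNReal.ofReal_le_ofReal ?_
    have hf : (k : ℝ) ^ k / k.factorial ≤ 3 ^ k := by
      refine (Real.pow_div_factorial_le_exp (k : ℝ) (by positivity) k).trans ?_
      rw [← mul_one (k : ℝ), Real.exp_nat_mul]
      exact pow_le_pow_left₀ (Real.exp_pos _).le (Real.exp_one_lt_d9.le.trans (by norm_num)) _
    calc (12 * R ^ 2)⁻¹ ^ k / k.factorial * (2 * k * R ^ 2) ^ k
        = ((12 * R ^ 2)⁻¹ * (2 * R ^ 2)) ^ k * ((k : ℝ) ^ k / k.factorial) := by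
          rw [show (2 * k * R ^ 2 : ℝ) = (2 * R ^ 2) * k by ring, mul_pow (2 * R ^ 2),
            mul_pow _ (2 * R ^ 2)]
          ring
      _ ≤ ((12 * R ^ 2)⁻¹ * (2 * R ^ 2)) ^ k * 3 ^ k :=
          mul_le_mul_of_nonneg_left hf (by positivity)
      _ = (1 / 2) ^ k := by
          rw [← mul_pow]
          congr 1
          field_simp
          norm_num
  simp_rw [e1]
  rw [lintegral_tsum (fun k => by fun_prop)]
  calc _ ≤ ∑' k : ℕ, (2⁻¹ : ℝ≥0∞) ^ k := by
        refine ENNReal.tsum_le_tsum fun k => ?_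
        rw [lintegral_const_mul _ (by fun_prop)]
        exact e2 k
    _ = 2 := by rw [ENNReal.tsum_geometric, ENNReal.one_sub_inv_two, inv_inv]

lemma lintegral_exp_le_of_le_sq [IsProbabilityMeasure P] (hX : Measurable X) (hR : 0 < R)
    (h : subGaussianNorm P X ≤ ENNReal.ofReal R) {f : Ω → ℝ} {a : ℝ}
    (hf : ∀ ω, f ω ≤ X ω ^ 2 / (12 * R ^ 2) + a) :
    ∫⁻ ω, ENNReal.ofReal (Real.exp (f ω)) ∂P ≤ ENNReal.ofReal (2 * Real.exp a) := by
  calc _ ≤ ∫⁻ ω, ENNReal.ofReal (Real.exp a) *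
          ENNReal.ofReal (Real.exp (X ω ^ 2 / (12 * R ^ 2))) ∂P := by
        refine lintegral_mono fun ω => ?_
        rw [← ENNReal.ofReal_mul (Real.exp_pos _).le, ← Real.exp_add]
        exact ENNReal.ofReal_le_ofReal (Real.exp_le_exp.2 (by linarith [hf ω]))
    _ ≤ ENNReal.ofReal (Real.exp a) * 2 := by
        rw [lintegral_const_mul _ (by fun_prop)]
        exact mul_le_mul_right (lintegral_exp_sq_le hX hR h) _
    _ = _ := by
        rw [mul_comm, ENNReal.ofReal_mul (by norm_num)]; simp

/-- Source of K = 3 below: both the rescaled variable and its rescaled centred square are bounded by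
X²/(12R²) + 1/4 in absolute value. -/
lemma two_mul_exp_quarter_le : 2 * Real.exp (1 / 4) ≤ 3 := by
  have := Real.exp_bound_div_one_sub_of_interval (x := 1 / 4) (by norm_num) (by norm_num)
  norm_num at this ⊢
  linarith

/-- The moment generating function of a centred sub-Gaussian random variable. -/
theorem lintegral_exp_mul_le [IsProbabilityMeasure P] (hX : Measurable X) (hR : 0 < R)
    (h : subGaussianNorm P X ≤ ENNReal.ofReal R) (h0 : ∫ ω, X ω ∂P = 0) (t : ℝ) :
    ∫⁻ ω, ENNReal.ofReal (Real.exp (t * X ω)) ∂P ≤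
      ENNReal.ofReal (Real.exp (36 * R ^ 2 * t ^ 2)) := by
  set r : ℝ := Real.sqrt (12 * R ^ 2) with hr
  have hr2 : r ^ 2 = 12 * R ^ 2 := Real.sq_sqrt (by positivity)
  have hr0 : 0 < r := Real.sqrt_pos.2 (by positivity)
  have hprod : ∀ a x : ℝ, a * x ≤ x ^ 2 / (12 * R ^ 2) + a ^ 2 * r ^ 2 / 4 := by
    intro a x
    rw [← hr2]
    have : 0 ≤ (x / r - a * r / 2) ^ 2 := sq_nonneg _
    have e : (x / r - a * r / 2) ^ 2 = x ^ 2 / r ^ 2 + a ^ 2 * r ^ 2 / 4 - a * x := by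
      field_simp
      ring
    linarith
  -- For small t centring is essential. For |t r| > 1 Young's inequality suffices, since the
  -- prefactor 2 is below exp(t²r²).
  rcases le_or_gt (|t * r|) 1 with ht | ht
  · have := lintegral_exp_mul_le_of_centered (P := P) (Z := fun ω => X ω / r) (K := 3) (s := t * r)
      (by fun_prop) (by norm_num) (by rw [integral_div, h0, zero_div]) ?_ ht
    · refine le_of_eq_of_le (lintegral_congr fun ω => ?_) (this.trans_eq ?_)
      · congr 2; field_simp
      · congr 2; rw [mul_pow, hr2]; ring
    · refine (lintegral_exp_le_of_le_sq hX hR h (a := 1 / 4) fun ω => ?_).trans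
        (ENNReal.ofReal_le_ofReal two_mul_exp_quarter_le)
      have h1 := hprod (1 / r) (X ω)
      have h2 := hprod (-(1 / r)) (X ω)
      rw [neg_sq] at h2
      have h3 : (1 / r) ^ 2 * r ^ 2 / 4 = 1 / 4 := by field_simp
      rw [h3] at h1 h2
      rw [abs_le']
      constructor
      · calc X ω / r = 1 / r * X ω := by ring
          _ ≤ _ := h1
      · calc -(X ω / r) = -(1 / r) * X ω := by ring
          _ ≤ _ := h2
  · refine (lintegral_exp_le_of_le_sq hX hR h (fun ω => hprod t (X ω))).trans
      (ENNReal.ofReal_le_ofReal ?_)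
    have h1 : 1 ≤ t ^ 2 * r ^ 2 := by
      rw [← mul_pow, ← sq_abs]
      exact one_le_pow₀ ht.le
    have h2 : (2 : ℝ) ≤ Real.exp (t ^ 2 * r ^ 2) := by
      linarith [Real.add_one_le_exp (t ^ 2 * r ^ 2)]
    calc 2 * Real.exp (t ^ 2 * r ^ 2 / 4)
        ≤ Real.exp (t ^ 2 * r ^ 2) * Real.exp (t ^ 2 * r ^ 2 / 4) :=
          mul_le_mul_of_nonneg_right h2 (Real.exp_pos _).le
      _ ≤ _ := by
          rw [← Real.exp_add, hr2]
          refine Real.exp_le_exp.2 ?_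
          nlinarith [mul_nonneg (sq_nonneg R) (sq_nonneg t)]

/-- The second moment is controlled by the sub-Gaussian norm. -/
lemma second_moment_le [IsProbabilityMeasure P] (hX : Measurable X) (hR : 0 ≤ R)
    (h : subGaussianNorm P X ≤ ENNReal.ofReal R) (hσ : ∫ ω, X ω ^ 2 ∂P = σ ^ 2) :
    σ ^ 2 ≤ 2 * R ^ 2 := by
  have h1 := lintegral_pow_le_of_subGaussianNorm_le hR h one_ne_zero
  rw [← hσ, integral_eq_lintegral_of_nonneg_ae (Filter.Eventually.of_forall fun _ => sq_nonneg _)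
    (by fun_prop)]
  exact ENNReal.toReal_le_of_le_ofReal (by positivity) (by simpa using h1)

/-- The moment generating function of the centred square of a sub-Gaussian random variable. -/
theorem lintegral_exp_mul_sq_sub_le [IsProbabilityMeasure P] (hX : Measurable X) (hR : 0 < R)
    (h : subGaussianNorm P X ≤ ENNReal.ofReal R) (hσ : ∫ ω, X ω ^ 2 ∂P = σ ^ 2)
    {u : ℝ} (hu : |u| * (12 * R ^ 2) ≤ 1) :
    ∫⁻ ω, ENNReal.ofReal (Real.exp (u * (X ω ^ 2 - σ ^ 2))) ∂P ≤
      ENNReal.ofReal (Real.exp (432 * R ^ 4 * u ^ 2)) := by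
  have hσR := second_moment_le hX hR.le h hσ
  have hR2 : 0 < 12 * R ^ 2 := by positivity
  have hint : Integrable (fun ω => X ω ^ 2) P := by
    have := lintegral_pow_le_of_subGaussianNorm_le hR.le h one_ne_zero
    rw [mul_one] at this
    exact integrable_of_lintegral_ofReal_le (by fun_prop) (fun _ => sq_nonneg _) this
  have := lintegral_exp_mul_le_of_centered (P := P) (Z := fun ω => (X ω ^ 2 - σ ^ 2) / (12 * R ^ 2))
      (K := 3) (s := u * (12 * R ^ 2)) (by fun_prop) (by norm_num) ?_ ?_
      (by rwa [abs_mul, abs_of_pos hR2])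
  · refine le_of_eq_of_le (lintegral_congr fun ω => ?_) (this.trans_eq ?_)
    · congr 2; field_simp
    · congr 2; ring
  · rw [integral_div, integral_sub hint (integrable_const _), hσ]
    simp
  · refine (lintegral_exp_le_of_le_sq hX hR h (a := 1 / 4) fun ω => ?_).trans
        (ENNReal.ofReal_le_ofReal two_mul_exp_quarter_le)
    rw [abs_div, abs_of_pos hR2]
    -- Uses σ² ≤ 2R²; the slack 3R² becomes exactly 1/4 after division by 12R².
    have h1 : |X ω ^ 2 - σ ^ 2| ≤ X ω ^ 2 + 3 * R ^ 2 := by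
      rw [abs_le]
      constructor <;> nlinarith [sq_nonneg (X ω), sq_nonneg σ, sq_nonneg R]
    calc |X ω ^ 2 - σ ^ 2| / (12 * R ^ 2) ≤ (X ω ^ 2 + 3 * R ^ 2) / (12 * R ^ 2) :=
          div_le_div_of_nonneg_right h1 hR2.le
      _ = _ := by field_simp; ring

end Moments

/-! ### A Hanson-Wright bound for exponential moments of quadratic forms. -/

section QuadraticForms

/-- Read from right to left, this linearises the exponential of a square. -/
lemma lintegral_exp_mul_gaussianReal (t : ℝ) :
    ∫⁻ x, ENNReal.ofReal (Real.exp (t * x)) ∂(gaussianReal 0 1) =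
      ENNReal.ofReal (Real.exp (t ^ 2 / 2)) := by
  rw [← ofReal_integral_eq_lintegral_ofReal (integrable_exp_mul_gaussianReal t)
    (Filter.Eventually.of_forall fun _ => (Real.exp_pos _).le)]
  congr 1
  have := congrFun (mgf_id_gaussianReal (μ := 0) (v := 1)) t
  simpa [mgf] using this

/-- The tilted density is √v times the Gaussian density of variance v = 1/(1-2a), and (1-2a)(1+4a) ≥
1 for 0 ≤ a ≤ 1/4 gives √v ≤ exp(2a). -/
lemma lintegral_exp_mul_sq_gaussianReal_le {a : ℝ} (ha0 : 0 ≤ a) (ha : a ≤ 1 / 4) :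
    ∫⁻ x, ENNReal.ofReal (Real.exp (a * x ^ 2)) ∂(gaussianReal 0 1) ≤
      ENNReal.ofReal (Real.exp (2 * a)) := by
  have hd : 0 < 1 - 2 * a := by linarith
  set v : NNReal := ⟨(1 - 2 * a)⁻¹, by positivity⟩ with hv
  have hv' : (v : ℝ) = (1 - 2 * a)⁻¹ := rfl
  have hv0 : v ≠ 0 := by
    intro h
    have : (v : ℝ) = 0 := by rw [h]; rfl
    rw [hv'] at this
    exact (inv_pos.2 hd).ne' this
  have key : ∀ x, gaussianPDF 0 1 x * ENNReal.ofReal (Real.exp (a * x ^ 2)) =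
      ENNReal.ofReal (Real.sqrt v) * gaussianPDF 0 v x := by
    intro x
    simp only [gaussianPDF, gaussianPDFReal]
    rw [← ENNReal.ofReal_mul (by positivity), ← ENNReal.ofReal_mul (by positivity)]
    congr 1
    have hs : 0 < Real.sqrt (v : ℝ) := Real.sqrt_pos.2 (by rw [hv']; positivity)
    rw [Real.sqrt_mul (by positivity) (v : ℝ), mul_assoc, ← Real.exp_add]
    have e : -(x - 0) ^ 2 / (2 * ((1 : NNReal) : ℝ)) + a * x ^ 2 = -(x - 0) ^ 2 / (2 * (v : ℝ)) := by
      rw [hv']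
      field_simp
      push_cast
      ring
    rw [e]
    simp only [NNReal.coe_one, mul_one]
    field_simp
  rw [gaussianReal_of_var_ne_zero 0 one_ne_zero,
    lintegral_withDensity_eq_lintegral_mul _ (measurable_gaussianPDF 0 1) (by fun_prop)]
  simp only [Pi.mul_apply, key]
  rw [lintegral_const_mul _ (measurable_gaussianPDF 0 v), lintegral_gaussianPDF_eq_one 0 hv0,
    mul_one]
  refine ENNReal.ofReal_le_ofReal (Real.sqrt_le_iff.2 ⟨(Real.exp_pos _).le, ?_⟩)
  rw [hv', ← Real.exp_nat_mul, inv_le_iff_one_le_mul₀ hd]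
  have := Real.add_one_le_exp (((2 : ℕ) : ℝ) * (2 * a))
  push_cast at this ⊢
  nlinarith

variable {Ω : Type*} [MeasurableSpace Ω] {P : Measure Ω} {ι κ : Type*} [Fintype ι] [Fintype κ]

lemma ofReal_exp_sum {α : Type*} (s : Finset α) (f : α → ℝ) :
    ENNReal.ofReal (Real.exp (∑ i ∈ s, f i)) = ∏ i ∈ s, ENNReal.ofReal (Real.exp (f i)) := by
  rw [Real.exp_sum, ENNReal.ofReal_prod_of_nonneg fun _ _ => (Real.exp_pos _).le]

/-- Exponential moments of sums of functions of independent random variables. -/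
lemma lintegral_exp_sum_le {X : ι → Ω → ℝ} (hX : ∀ i, Measurable (X i)) (hind : iIndepFun X P)
    {f : ι → ℝ → ℝ} (hf : ∀ i, Measurable (f i)) {b : ι → ℝ}
    (h : ∀ i, ∫⁻ ω, ENNReal.ofReal (Real.exp (f i (X i ω))) ∂P ≤
      ENNReal.ofReal (Real.exp (b i))) :
    ∫⁻ ω, ENNReal.ofReal (Real.exp (∑ i, f i (X i ω))) ∂P ≤
      ENNReal.ofReal (Real.exp (∑ i, b i)) := by
  simp only [ofReal_exp_sum]
  rw [lintegral_prod_eq_prod_lintegral_of_indepFun Finset.univ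
    (fun i ω => ENNReal.ofReal (Real.exp (f i (X i ω))))
    (hind.comp (fun i x => ENNReal.ofReal (Real.exp (f i x))) fun i => by fun_prop)
    fun i => by fun_prop]
  exact Finset.prod_le_prod' fun i _ => h i

lemma lintegral_exp_linear_le {X : ι → Ω → ℝ} (hX : ∀ i, Measurable (X i)) (hind : iIndepFun X P)
    {c : ℝ} (h : ∀ i t, ∫⁻ ω, ENNReal.ofReal (Real.exp (t * X i ω)) ∂P ≤
      ENNReal.ofReal (Real.exp (c * t ^ 2))) (a : ι → ℝ) :
    ∫⁻ ω, ENNReal.ofReal (Real.exp (∑ i, a i * X i ω)) ∂P ≤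
      ENNReal.ofReal (Real.exp (c * ∑ i, a i ^ 2)) := by
  rw [Finset.mul_sum]
  exact lintegral_exp_sum_le hX hind (f := fun i x => a i * x) (fun i => by fun_prop)
    fun i => h i (a i)

/-- Schur's test for nonnegative matrices. -/
lemma sum_sq_mulVec_le (B : Matrix κ ι ℝ) {r : ℝ} (hB : ∀ k i, 0 ≤ B k i)
    (hrow : ∀ k, ∑ i, B k i ≤ r) (hcol : ∀ i, ∑ k, B k i ≤ r) (x : ι → ℝ) :
    ∑ k, (B *ᵥ x) k ^ 2 ≤ r ^ 2 * ∑ i, x i ^ 2 := by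
  rcases isEmpty_or_nonempty κ with hκ | ⟨⟨k₀⟩⟩
  · simp only [Finset.univ_eq_empty, Finset.sum_empty]
    exact mul_nonneg (sq_nonneg r) (Finset.sum_nonneg fun _ _ => sq_nonneg _)
  have hr : 0 ≤ r := (Finset.sum_nonneg fun i _ => hB k₀ i).trans (hrow k₀)
  calc ∑ k, (B *ᵥ x) k ^ 2 ≤ ∑ k, r * ∑ i, B k i * x i ^ 2 := by
        refine Finset.sum_le_sum fun k _ => ?_
        -- Cauchy-Schwarz with the entries of the row as weights.
        have h1 : (B *ᵥ x) k ^ 2 ≤ (∑ i, B k i) * ∑ i, B k i * x i ^ 2 :=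
          Finset.sum_sq_le_sum_mul_sum_of_sq_le_mul _ (fun i _ => hB k i)
            (fun i _ => mul_nonneg (hB k i) (sq_nonneg _)) fun i _ => le_of_eq (by ring)
        exact h1.trans (mul_le_mul_of_nonneg_right (hrow k)
          (Finset.sum_nonneg fun i _ => mul_nonneg (hB k i) (sq_nonneg _)))
    _ = r * ∑ i, (∑ k, B k i) * x i ^ 2 := by
        rw [← Finset.mul_sum, Finset.sum_comm]
        simp only [Finset.sum_mul]
    _ ≤ r * ∑ i, r * x i ^ 2 :=
        mul_le_mul_of_nonneg_left (Finset.sum_le_sum fun i _ =>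
          mul_le_mul_of_nonneg_right (hcol i) (sq_nonneg _)) hr
    _ = _ := by rw [← Finset.mul_sum]; ring

/-- The singular value decomposition of the quadratic form `‖B x‖²`. -/
lemma exists_diagonalization (B : Matrix κ ι ℝ) {r : ℝ}
    (hB : ∀ x, ∑ k, (B *ᵥ x) k ^ 2 ≤ r ^ 2 * ∑ i, x i ^ 2) :
    ∃ (l : ι → ℝ) (u : ι → ι → ℝ), (∀ k, 0 ≤ l k) ∧ (∀ k, l k ≤ r ^ 2) ∧
      ∑ k, l k = ∑ k, ∑ i, B k i ^ 2 ∧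
      (∀ x, ∑ k, (B *ᵥ x) k ^ 2 = ∑ k, l k * (u k ⬝ᵥ x) ^ 2) ∧
      ∀ a : ι → ℝ, ∑ i, (∑ k, a k * u k i) ^ 2 = ∑ k, a k ^ 2 := by
  classical
  have hG : (Bᴴ * B).IsHermitian := Matrix.isHermitian_conjTranspose_mul_self B
  set b := hG.eigenvectorBasis with hb
  have hnn : ∀ k, 0 ≤ hG.eigenvalues k := Matrix.eigenvalues_conjTranspose_mul_self_nonneg B
  have hform : ∀ x : ι → ℝ, ∑ k, (B *ᵥ x) k ^ 2 = x ⬝ᵥ ((Bᴴ * B) *ᵥ x) := by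
    intro x
    rw [← Matrix.mulVec_mulVec, Matrix.dotProduct_mulVec, Matrix.conjTranspose_eq_transpose_of_trivial,
      Matrix.vecMul_transpose]
    simp [dotProduct, sq]
  have hdot : ∀ x y : EuclideanSpace ℝ ι, inner ℝ x y = x.ofLp ⬝ᵥ y.ofLp := by
    intro x y
    rw [EuclideanSpace.inner_eq_star_dotProduct, dotProduct_comm]
    simp
  have hpar : ∀ a : ι → ℝ, ∑ i, (∑ k, a k * (b k).ofLp i) ^ 2 = ∑ k, a k ^ 2 := by
    intro a
    have h1 := b.sum_repr_symm (WithLp.toLp 2 a)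
    have h2 := b.repr.symm.norm_map (WithLp.toLp 2 a)
    rw [← h1, EuclideanSpace.norm_eq, EuclideanSpace.norm_eq,
      Real.sqrt_inj (Finset.sum_nonneg fun _ _ => sq_nonneg _)
        (Finset.sum_nonneg fun _ _ => sq_nonneg _)] at h2
    simpa [Finset.sum_apply] using h2
  have heig : ∀ (k : ι) (x : ι → ℝ), (b k).ofLp ⬝ᵥ ((Bᴴ * B) *ᵥ x) =
      hG.eigenvalues k * ((b k).ofLp ⬝ᵥ x) := by
    intro k x
    have h1 := hG.mulVec_eigenvectorBasis k
    have h2 : (Bᴴ * B)ᵀ = Bᴴ * B := by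
      rw [← Matrix.conjTranspose_eq_transpose_of_trivial]; exact hG
    rw [Matrix.dotProduct_mulVec, ← Matrix.mulVec_transpose, h2, h1, smul_dotProduct, smul_eq_mul]
  refine ⟨hG.eigenvalues, fun k => (b k).ofLp, hnn, fun k => ?_, ?_, fun x => ?_, hpar⟩
  · have h1 := hB (b k).ofLp
    have h2 := hpar (Pi.single k 1)
    simp only [Pi.single_apply, ite_mul, one_mul, zero_mul, Finset.sum_ite_eq', Finset.mem_univ,
      if_true, ite_pow, one_pow, ne_eq, OfNat.ofNat_ne_zero, not_false_eq_true, zero_pow] at h2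
    have h3 : (b k).ofLp ⬝ᵥ (b k).ofLp = 1 := by
      rw [← h2]; simp [dotProduct, sq]
    rw [hform, heig, h3, h2, mul_one, mul_one] at h1
    exact h1
  · have h1 := hG.trace_eq_sum_eigenvalues
    have h2 : (Bᴴ * B).trace = ∑ k, ∑ i, B k i ^ 2 := by
      rw [Finset.sum_comm]
      simp [Matrix.trace, Matrix.mul_apply, sq]
    rw [← h2, h1]
    simp
  · rw [hform]
    have h1 := b.sum_inner_mul_inner (WithLp.toLp 2 x) (WithLp.toLp 2 ((Bᴴ * B) *ᵥ x))
    simp only [hdot] at h1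
    rw [← h1]
    refine Finset.sum_congr rfl fun k _ => ?_
    rw [heig, dotProduct_comm]
    ring

/-- Exponential moments of `‖B X‖²` for a vector `X` with independent sub-Gaussian entries. -/
theorem lintegral_exp_mulVec_sq_le [IsProbabilityMeasure P] {X : ι → Ω → ℝ}
    (hX : ∀ i, Measurable (X i)) (hind : iIndepFun X P) {c : ℝ} (hc : 0 ≤ c)
    (h : ∀ i t, ∫⁻ ω, ENNReal.ofReal (Real.exp (t * X i ω)) ∂P ≤
      ENNReal.ofReal (Real.exp (c * t ^ 2)))
    (B : Matrix κ ι ℝ) {r : ℝ} (hB : ∀ x, ∑ k, (B *ᵥ x) k ^ 2 ≤ r ^ 2 * ∑ i, x i ^ 2)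
    {τ : ℝ} (hτ : 0 ≤ τ) (hτr : 8 * c * τ * r ^ 2 ≤ 1) :
    ∫⁻ ω, ENNReal.ofReal (Real.exp (τ * ∑ k, (B *ᵥ fun i => X i ω) k ^ 2)) ∂P ≤
      ENNReal.ofReal (Real.exp (4 * c * τ * ∑ k, ∑ i, B k i ^ 2)) := by
  obtain ⟨l, u, hl0, hlr, htr, hform, hpar⟩ := exists_diagonalization B hB
  set γ : Measure (ι → ℝ) := Measure.pi fun _ => gaussianReal 0 1 with hγ
  have hgind : iIndepFun (fun (i : ι) (g : ι → ℝ) => g i) γ :=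
    iIndepFun_pi (X := fun _ x => x) fun i => by fun_prop
  have hcoord : ∀ (k : ι) {f : ℝ → ℝ≥0∞}, Measurable f →
      ∫⁻ g, f (g k) ∂γ = ∫⁻ x, f x ∂(gaussianReal 0 1) := fun k f hf =>
    (measurePreserving_eval (fun _ : ι => gaussianReal 0 1) k).lintegral_comp hf
  -- Chosen so that a standard Gaussian multiplied by d k * y k has exponential moment exp(τ l_k
  -- y_k²).
  set d : ι → ℝ := fun k => Real.sqrt (2 * τ * l k) with hd
  have hd2 : ∀ k, d k ^ 2 = 2 * τ * l k := fun k =>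
    Real.sq_sqrt (mul_nonneg (by positivity) (hl0 k))
  have hlin : ∀ y : ι → ℝ, ∫⁻ g, ENNReal.ofReal (Real.exp (∑ k, d k * y k * g k)) ∂γ =
      ENNReal.ofReal (Real.exp (τ * ∑ k, l k * y k ^ 2)) := by
    intro y
    simp only [ofReal_exp_sum]
    rw [lintegral_prod_eq_prod_lintegral_of_indepFun Finset.univ
      (fun k (g : ι → ℝ) => ENNReal.ofReal (Real.exp (d k * y k * g k)))
      (hgind.comp (fun k x => ENNReal.ofReal (Real.exp (d k * y k * x))) fun k => by fun_prop)
      fun k => by fun_prop, Finset.mul_sum, ofReal_exp_sum]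
    refine Finset.prod_congr rfl fun k _ => ?_
    rw [hcoord k (f := fun x => ENNReal.ofReal (Real.exp (d k * y k * x))) (by fun_prop),
      lintegral_exp_mul_gaussianReal, mul_pow, hd2]
    congr 2
    ring
  -- For fixed g the exponent is linear in X, and orthonormality makes the squared norm of its
  -- coefficients Σ d_k² g_k².
  have hexch : ∀ (g : ι → ℝ) (ω : Ω), ∑ k, d k * (u k ⬝ᵥ fun i => X i ω) * g k =
      ∑ i, (∑ k, d k * g k * u k i) * X i ω := by
    intro g ω
    simp only [dotProduct, Finset.mul_sum, Finset.sum_mul]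
    rw [Finset.sum_comm]
    exact Finset.sum_congr rfl fun i _ => Finset.sum_congr rfl fun k _ => by ring
  calc ∫⁻ ω, ENNReal.ofReal (Real.exp (τ * ∑ k, (B *ᵥ fun i => X i ω) k ^ 2)) ∂P
      = ∫⁻ ω, ∫⁻ g, ENNReal.ofReal (Real.exp (∑ i, (∑ k, d k * g k * u k i) * X i ω)) ∂γ ∂P := by
        refine lintegral_congr fun ω => ?_
        rw [hform, ← hlin]
        simp only [hexch]
    _ = ∫⁻ g, ∫⁻ ω, ENNReal.ofReal (Real.exp (∑ i, (∑ k, d k * g k * u k i) * X i ω)) ∂P ∂γ := by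
        refine lintegral_lintegral_swap (Measurable.aemeasurable ?_)
        simp only [Function.uncurry_def]
        fun_prop
    _ ≤ ∫⁻ g, ENNReal.ofReal (Real.exp (∑ k, c * (2 * τ * l k) * g k ^ 2)) ∂γ := by
        refine lintegral_mono fun g => ?_
        refine (lintegral_exp_linear_le hX hind h _).trans_eq ?_
        rw [hpar, Finset.mul_sum]
        congr 2
        refine Finset.sum_congr rfl fun k _ => ?_
        rw [mul_pow, hd2]
        ring
    _ ≤ ENNReal.ofReal (Real.exp (∑ k, 2 * (c * (2 * τ * l k)))) := by
        refine lintegral_exp_sum_le (fun k => measurable_pi_apply k) hgind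
          (f := fun k x => c * (2 * τ * l k) * x ^ 2) (fun k => by fun_prop) fun k => ?_
        rw [hcoord k (f := fun x => ENNReal.ofReal (Real.exp (c * (2 * τ * l k) * x ^ 2)))
          (by fun_prop)]
        refine lintegral_exp_mul_sq_gaussianReal_le
          (mul_nonneg hc (mul_nonneg (by positivity) (hl0 k))) ?_
        nlinarith [mul_le_mul_of_nonneg_left (hlr k) (mul_nonneg hc hτ)]
    _ = _ := by
        rw [← htr, Finset.mul_sum]
        congr 2
        exact Finset.sum_congr rfl fun k _ => by ring

/-- Exponential moments of a decoupled bilinear form in independent sub-Gaussian variables. -/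
theorem lintegral_exp_bilinear_le [IsProbabilityMeasure P] [DecidableEq ι] {X : ι → Ω → ℝ}
    (hX : ∀ i, Measurable (X i)) (hind : iIndepFun X P) {c : ℝ} (hc : 0 ≤ c)
    (h : ∀ i t, ∫⁻ ω, ENNReal.ofReal (Real.exp (t * X i ω)) ∂P ≤
      ENNReal.ofReal (Real.exp (c * t ^ 2)))
    (B : Matrix ι ι ℝ) {r : ℝ} (hB : ∀ k i, 0 ≤ B k i)
    (hrow : ∀ k, ∑ i, B k i ≤ r) (hcol : ∀ i, ∑ k, B k i ≤ r) (I : Finset ι)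
    {θ : ℝ} (hθ : 8 * c ^ 2 * θ ^ 2 * r ^ 2 ≤ 1) :
    ∫⁻ ω, ENNReal.ofReal (Real.exp (θ * ∑ i ∈ I, ∑ j ∈ Iᶜ, B i j * X i ω * X j ω)) ∂P ≤
      ENNReal.ofReal (Real.exp (4 * c ^ 2 * θ ^ 2 * ∑ i, ∑ j, B i j ^ 2)) := by
  -- The halves U and V are independent: for fixed V the form is linear in U, so integrating U out
  -- leaves the exponential of a multiple of ‖C V‖².
  set U : Ω → I → ℝ := fun ω i => X i ω with hU
  set V : Ω → (Iᶜ : Finset ι) → ℝ := fun ω j => X j ω with hV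
  have hUm : Measurable U := measurable_pi_lambda _ fun i => hX i
  have hVm : Measurable V := measurable_pi_lambda _ fun i => hX i
  have hUV : IndepFun U V P := hind.indepFun_finset I Iᶜ disjoint_compl_right hX
  have hmap := (indepFun_iff_map_prod_eq_prod_map_map hUm.aemeasurable hVm.aemeasurable).1 hUV
  set C : Matrix I (Iᶜ : Finset ι) ℝ := B.submatrix (fun i => (i : ι)) fun j => (j : ι) with hC
  set F : (I → ℝ) × ((Iᶜ : Finset ι) → ℝ) → ℝ≥0∞ := fun p =>
    ENNReal.ofReal (Real.exp (∑ i, θ * (C *ᵥ p.2) i * p.1 i)) with hF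
  have hFm : Measurable F := by
    simp only [hF, Matrix.mulVec, dotProduct]
    fun_prop
  have e : ∀ ω, ENNReal.ofReal (Real.exp (θ * ∑ i ∈ I, ∑ j ∈ Iᶜ, B i j * X i ω * X j ω)) =
      F (U ω, V ω) := by
    intro ω
    simp only [hF, hU, hV, hC, Matrix.mulVec, dotProduct, Matrix.submatrix_apply]
    congr 2
    rw [Finset.mul_sum, ← Finset.sum_coe_sort I]
    refine Finset.sum_congr rfl fun i _ => ?_
    rw [← Finset.sum_coe_sort Iᶜ, Finset.mul_sum, Finset.mul_sum, Finset.sum_mul]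
    exact Finset.sum_congr rfl fun j _ => by ring
  have hsub : ∀ (J : Finset ι) (f : ι → ℝ), (∀ i, 0 ≤ f i) → ∑ i : J, f i ≤ ∑ i, f i := by
    intro J f hf
    rw [Finset.sum_coe_sort J f]
    exact Finset.sum_le_sum_of_subset_of_nonneg (Finset.subset_univ _) fun i _ _ => hf i
  have : IsProbabilityMeasure (P.map U) := Measure.isProbabilityMeasure_map hUm.aemeasurable
  have : IsProbabilityMeasure (P.map V) := Measure.isProbabilityMeasure_map hVm.aemeasurable
  calc _ = ∫⁻ ω, F (U ω, V ω) ∂P := lintegral_congr e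
    _ = ∫⁻ p, F p ∂((P.map U).prod (P.map V)) := by
        rw [← hmap, lintegral_map hFm (hUm.prodMk hVm)]
    _ = ∫⁻ v, ∫⁻ w, F (w, v) ∂(P.map U) ∂(P.map V) := lintegral_prod_symm' _ hFm
    _ ≤ ∫⁻ v, ENNReal.ofReal (Real.exp (c * θ ^ 2 * ∑ i, (C *ᵥ v) i ^ 2)) ∂(P.map V) := by
        refine lintegral_mono fun v => ?_
        rw [lintegral_map (by fun_prop) hUm]
        refine (lintegral_exp_linear_le (X := fun i : I => X i) (fun i => hX i)
          (hind.precomp Subtype.val_injective) (fun i t => h i t) fun i => θ * (C *ᵥ v) i).trans_eq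
          ?_
        simp only [mul_pow, ← Finset.mul_sum, mul_assoc]
    _ = ∫⁻ ω, ENNReal.ofReal (Real.exp (c * θ ^ 2 *
          ∑ i, (C *ᵥ fun j : (Iᶜ : Finset ι) => X j ω) i ^ 2)) ∂P := by
        rw [lintegral_map _ hVm]
        simp only [Matrix.mulVec, dotProduct]
        fun_prop
    _ ≤ ENNReal.ofReal (Real.exp (4 * c * (c * θ ^ 2) * ∑ k, ∑ i, C k i ^ 2)) := by
        refine lintegral_exp_mulVec_sq_le (X := fun i : (Iᶜ : Finset ι) => X i) (fun i => hX i)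
          (hind.precomp Subtype.val_injective) hc (fun i t => h i t) C
          (sum_sq_mulVec_le C (fun k i => hB k i) (r := r) (fun k => ?_) fun i => ?_)
          (by positivity) (by linarith)
        · exact (hsub Iᶜ (fun i => B k i) fun i => hB k i).trans (hrow k)
        · exact (hsub I (fun k => B k i) fun k => hB k i).trans (hcol i)
    _ ≤ _ := by
        refine ENNReal.ofReal_le_ofReal (Real.exp_le_exp.2 ?_)
        rw [show 4 * c * (c * θ ^ 2) = 4 * c ^ 2 * θ ^ 2 by ring]
        refine mul_le_mul_of_nonneg_left ?_ (by positivity)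
        refine (hsub I (fun k => ∑ i : (Iᶜ : Finset ι), B k i ^ 2) fun k =>
          Finset.sum_nonneg fun _ _ => sq_nonneg _).trans (Finset.sum_le_sum fun k _ => ?_)
        exact hsub Iᶜ (fun i => B k i ^ 2) fun i => sq_nonneg _

/-- Removing i is a bijection onto the subsets avoiding both i and j, a quarter of all subsets. -/
lemma card_filter_mem_notMem [DecidableEq ι] {i j : ι} (hij : i ≠ j) :
    4 * (Finset.univ.filter fun I : Finset ι => i ∈ I ∧ j ∉ I).card = 2 ^ Fintype.card ι := by
  have h1 : (Finset.univ.filter fun I : Finset ι => i ∈ I ∧ j ∉ I).card =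
      ((Finset.univ.erase j).erase i).powerset.card := by
    refine Finset.card_bij' (fun I _ => I.erase i) (fun I _ => insert i I) ?_ ?_ ?_ ?_
    · intro I hI
      simp only [Finset.mem_filter, Finset.mem_univ, true_and] at hI
      rw [Finset.mem_powerset]
      refine Finset.erase_subset_erase _ fun a ha => ?_
      simp only [Finset.mem_erase, Finset.mem_univ, and_true]
      rintro rfl
      exact hI.2 ha
    · intro I hI
      rw [Finset.mem_powerset] at hI
      simp only [Finset.mem_filter, Finset.mem_univ, true_and, Finset.mem_insert_self,
        Finset.mem_insert, not_or]
      refine ⟨hij.symm, fun hj => ?_⟩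
      simpa using hI hj
    · intro I hI
      simp only [Finset.mem_filter, Finset.mem_univ, true_and] at hI
      exact Finset.insert_erase hI.1
    · intro I hI
      rw [Finset.mem_powerset] at hI
      exact Finset.erase_insert fun hi => by simpa using hI hi
  rw [h1, Finset.card_powerset, Finset.card_erase_of_mem (by simp [hij]),
    Finset.card_erase_of_mem (Finset.mem_univ _), Finset.card_univ]
  have h2 : 2 ≤ Fintype.card ι := Fintype.one_lt_card_iff.2 ⟨i, j, hij⟩
  obtain ⟨k, hk⟩ := Nat.exists_eq_add_of_le h2
  rw [hk, show 2 + k - 1 - 1 = k by omega, pow_add]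
  norm_num

/-- Decoupling: a uniformly random I separates an ordered pair i ≠ j with probability 1/4, so an
off-diagonal form is 4 times the mean of its bipartite pieces. -/
lemma sum_sum_bipartition [DecidableEq ι] (f : ι → ι → ℝ) (hf : ∀ i, f i i = 0) :
    4 * ∑ I : Finset ι, ∑ i ∈ I, ∑ j ∈ Iᶜ, f i j = 2 ^ Fintype.card ι * ∑ i, ∑ j, f i j := by
  have e : ∀ I : Finset ι, ∑ i ∈ I, ∑ j ∈ Iᶜ, f i j =
      ∑ i, ∑ j, if i ∈ I ∧ j ∉ I then f i j else 0 := by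
    intro I
    rw [← Finset.sum_filter_add_sum_filter_not Finset.univ (· ∈ I)]
    have z : ∑ i ∈ Finset.univ.filter (fun i => i ∉ I),
        ∑ j, (if i ∈ I ∧ j ∉ I then f i j else 0) = 0 := by
      refine Finset.sum_eq_zero fun i hi => Finset.sum_eq_zero fun j _ => ?_
      rw [if_neg]
      exact fun h => (Finset.mem_filter.1 hi).2 h.1
    rw [z, add_zero]
    have : Finset.univ.filter (· ∈ I) = I := by ext; simp
    rw [this]
    refine Finset.sum_congr rfl fun i hi => ?_
    rw [← Finset.sum_filter]
    refine Finset.sum_congr ?_ fun _ _ => rfl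
    ext j
    simp [hi]
  simp only [e]
  rw [Finset.sum_comm, Finset.mul_sum, Finset.mul_sum]
  refine Finset.sum_congr rfl fun i _ => ?_
  rw [Finset.sum_comm, Finset.mul_sum, Finset.mul_sum]
  refine Finset.sum_congr rfl fun j _ => ?_
  rcases eq_or_ne i j with rfl | hij
  · simp [hf]
  · rw [← Finset.sum_filter, Finset.sum_const, nsmul_eq_mul, ← mul_assoc]
    congr 1
    exact_mod_cast card_filter_mem_notMem hij

/-- The Hanson-Wright bound for the exponential moments of an off-diagonal quadratic form. -/
theorem lintegral_exp_quadratic_le [IsProbabilityMeasure P] [DecidableEq ι] {X : ι → Ω → ℝ}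
    (hX : ∀ i, Measurable (X i)) (hind : iIndepFun X P) {c : ℝ} (hc : 0 ≤ c)
    (h : ∀ i t, ∫⁻ ω, ENNReal.ofReal (Real.exp (t * X i ω)) ∂P ≤
      ENNReal.ofReal (Real.exp (c * t ^ 2)))
    (B : Matrix ι ι ℝ) {r : ℝ} (hB : ∀ k i, 0 ≤ B k i) (hdiag : ∀ i, B i i = 0)
    (hrow : ∀ k, ∑ i, B k i ≤ r) (hcol : ∀ i, ∑ k, B k i ≤ r)
    {θ : ℝ} (hθ : 128 * c ^ 2 * θ ^ 2 * r ^ 2 ≤ 1) :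
    ∫⁻ ω, ENNReal.ofReal (Real.exp (θ * ∑ i, ∑ j, B i j * X i ω * X j ω)) ∂P ≤
      ENNReal.ofReal (Real.exp (64 * c ^ 2 * θ ^ 2 * ∑ i, ∑ j, B i j ^ 2)) := by
  have hn : (0 : ℝ) < 2 ^ Fintype.card ι := by positivity
  set w : ℝ := (2 ^ Fintype.card ι)⁻¹ with hw
  have hw0 : 0 ≤ w := by positivity
  have hcard : (Fintype.card (Finset ι) : ℝ) = 2 ^ Fintype.card ι := by
    rw [Fintype.card_finset]; push_cast; rfl
  have hws : ∑ _I : Finset ι, w = 1 := by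
    rw [Finset.sum_const, Finset.card_univ, nsmul_eq_mul, hcard]
    exact mul_inv_cancel₀ hn.ne'
  -- Jensen's inequality for the uniform average over all I; the decoupling factor turns θ into 4θ,
  -- whence 128 = 8·16 and 64 = 4·16.
  have hpt : ∀ ω, Real.exp (θ * ∑ i, ∑ j, B i j * X i ω * X j ω) ≤
      ∑ I : Finset ι, w * Real.exp (4 * θ * ∑ i ∈ I, ∑ j ∈ Iᶜ, B i j * X i ω * X j ω) := by
    intro ω
    have h1 := convexOn_exp.map_sum_le (t := (Finset.univ : Finset (Finset ι)))
      (w := fun _ => w) (p := fun I => 4 * θ * ∑ i ∈ I, ∑ j ∈ Iᶜ, B i j * X i ω * X j ω)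
      (fun _ _ => hw0) hws fun _ _ => Set.mem_univ _
    simp only [smul_eq_mul] at h1
    refine le_of_eq_of_le (congrArg Real.exp ?_) h1
    have h2 := sum_sum_bipartition (fun i j => B i j * X i ω * X j ω) fun i => by simp [hdiag]
    rw [← Finset.mul_sum, ← Finset.mul_sum,
      show ∀ S : ℝ, w * (4 * θ * S) = w * θ * (4 * S) from fun S => by ring, h2, hw]
    field_simp
  calc _ ≤ ∫⁻ ω, ∑ I : Finset ι, ENNReal.ofReal w * ENNReal.ofReal
          (Real.exp (4 * θ * ∑ i ∈ I, ∑ j ∈ Iᶜ, B i j * X i ω * X j ω)) ∂P := by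
        refine lintegral_mono fun ω => ?_
        simp only [← ENNReal.ofReal_mul hw0]
        rw [← ENNReal.ofReal_sum_of_nonneg fun I _ => mul_nonneg hw0 (Real.exp_pos _).le]
        exact ENNReal.ofReal_le_ofReal (hpt ω)
    _ = ∑ I : Finset ι, ENNReal.ofReal w * ∫⁻ ω, ENNReal.ofReal
          (Real.exp (4 * θ * ∑ i ∈ I, ∑ j ∈ Iᶜ, B i j * X i ω * X j ω)) ∂P := by
        rw [lintegral_finsetSum _ fun I _ => by fun_prop]
        exact Finset.sum_congr rfl fun I _ => lintegral_const_mul _ (by fun_prop)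
    _ ≤ ∑ _I : Finset ι, ENNReal.ofReal w *
          ENNReal.ofReal (Real.exp (4 * c ^ 2 * (4 * θ) ^ 2 * ∑ i, ∑ j, B i j ^ 2)) :=
        Finset.sum_le_sum fun I _ => mul_le_mul_right
          (lintegral_exp_bilinear_le hX hind hc h B hB hrow hcol I (by linarith)) _
    _ = _ := by
        rw [← Finset.sum_mul, ← ENNReal.ofReal_sum_of_nonneg fun _ _ => hw0, hws,
          ENNReal.ofReal_one, one_mul]
        congr 3
        ring

end QuadraticForms

/-! ### Construction of the certificates. -/

section Certificates

variable {κ n : Type*} [Fintype κ] [Fintype n] [DecidableEq n]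

/-- The constant of the robust recovery guarantee. -/
def recoveryConstant (μ σ r M : ℝ) : ℝ :=
  Real.sqrt (9 * (16 * σ ^ 2 / μ ^ 2 + r) / (M * σ ^ 2))

/-- If the column sums of `D` are small and `Dᵀ D χ_T` is close to a multiple of `χ_T`, then the
biased matrix `μ 𝟙 + D` is bounded below on the cone of sign patterns given by `T`. -/
theorem cone_bound_of_gram (D : Matrix κ n ℝ) (T : Finset n) {μ σ t : ℝ} (hμ : 0 < μ) (hσ : 0 < σ)
    (hM : 0 < Fintype.card κ)
    (hcol : ∀ j, |∑ k, D k j| ≤ t) (ht : t ≤ μ * Fintype.card κ / 150)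
    (htT : T.card * t ^ 2 ≤ Fintype.card κ ^ 2 * σ ^ 2 / 150)
    (hgram : ∀ j, |∑ k, ∑ i ∈ T, D k j * D k i - (if j ∈ T then Fintype.card κ * σ ^ 2 else 0)| ≤
      Fintype.card κ * σ ^ 2 / 150)
    {h : n → ℝ} (hT : ∀ j ∈ T, h j ≤ 0) (hTc : ∀ j ∉ T, 0 ≤ h j) :
    2 * l2norm h ≤ recoveryConstant μ σ T.card (Fintype.card κ) * l2norm (biased μ D *ᵥ h) := by
  have hM' : (0 : ℝ) < Fintype.card κ := by exact_mod_cast hM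
  set M : ℝ := (Fintype.card κ : ℝ) with hMdef
  set r : ℝ := (T.card : ℝ) with hr
  have hr0 : 0 ≤ r := Nat.cast_nonneg _
  have hMs : 0 < M * σ ^ 2 := by positivity
  set u : κ → ℝ := fun k => ∑ i ∈ T, D k i with hu
  set S : ℝ := ∑ k, u k with hS
  have hone : ∀ x : ℝ, ∑ _k : κ, x = M * x := fun x => by
    rw [Finset.sum_const, Finset.card_univ, nsmul_eq_mul]
  have hgram' : ∀ j, ∑ k, ∑ i ∈ T, D k j * D k i = ∑ k, u k * D k j := by
    intro j
    refine Finset.sum_congr rfl fun k _ => ?_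
    rw [hu, Finset.sum_mul]
    exact Finset.sum_congr rfl fun i _ => mul_comm _ _
  simp only [hgram'] at hgram
  have hSle : |S| ≤ r * t := by
    have e : S = ∑ i ∈ T, ∑ k, D k i := Finset.sum_comm
    rw [e]
    refine (Finset.abs_sum_le_sum_abs _ _).trans ?_
    refine (Finset.sum_le_sum fun i _ => hcol i).trans_eq ?_
    rw [Finset.sum_const, nsmul_eq_mul]
  -- ‖Dχ_T‖² is the sum over T of the entries of DᵀDχ_T, so the Gram hypothesis bounds it too.
  have huu : ∑ k, u k ^ 2 ≤ 151 / 150 * r * (M * σ ^ 2) := by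
    have e : ∑ k, u k ^ 2 = ∑ j ∈ T, ∑ k, u k * D k j := by
      rw [Finset.sum_comm]
      refine Finset.sum_congr rfl fun k _ => ?_
      rw [← Finset.mul_sum, sq]
    rw [e]
    have : ∀ j ∈ T, ∑ k, u k * D k j ≤ 151 / 150 * (M * σ ^ 2) := by
      intro j hj
      have := (abs_le.1 (hgram j)).2
      rw [if_pos hj] at this
      linarith
    refine (Finset.sum_le_sum this).trans_eq ?_
    rw [Finset.sum_const, nsmul_eq_mul]
    ring
  -- Centring makes v₂ orthogonal to the bias; the correction it causes is what `htT` controls.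
  set v₂ : κ → ℝ := fun k => (u k - S / M) / (M * σ ^ 2) with hv₂
  set v₁ : κ → ℝ := fun k => 1 / (μ * M) - v₂ k with hv₁
  have hv₂sum : ∑ k, v₂ k = 0 := by
    rw [hv₂, ← Finset.sum_div, Finset.sum_sub_distrib, hone, ← hS]
    field_simp
    ring
  have hmul : ∀ (v : κ → ℝ) (j : n), (v ᵥ* biased μ D) j = μ * ∑ k, v k + ∑ k, v k * D k j := by
    intro v j
    simp only [Matrix.vecMul, dotProduct, biased, Matrix.add_apply, Matrix.smul_apply,
      Matrix.of_apply, smul_eq_mul, mul_one, Finset.mul_sum]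
    rw [← Finset.sum_add_distrib]
    exact Finset.sum_congr rfl fun k _ => by ring
  have hw₂ : ∀ j, (v₂ ᵥ* biased μ D) j =
      (∑ k, u k * D k j - S / M * ∑ k, D k j) / (M * σ ^ 2) := by
    intro j
    rw [hmul, hv₂sum, mul_zero, zero_add, Finset.mul_sum, ← Finset.sum_sub_distrib, Finset.sum_div]
    exact Finset.sum_congr rfl fun k _ => by rw [hv₂]; ring
  have hw₁ : ∀ j, (v₁ ᵥ* biased μ D) j =
      1 + (∑ k, D k j) / (μ * M) - (v₂ ᵥ* biased μ D) j := by
    intro j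
    have h1 : v₁ = (fun _ => 1 / (μ * M)) - v₂ := rfl
    rw [h1, Matrix.sub_vecMul, Pi.sub_apply, hmul, hone, ← Finset.mul_sum]
    congr 1
    field_simp
  -- One 1/150 comes from the Gram entry and one from the centring; v₁ adds a third from the column
  -- sum, so δ = 1/50.
  have hE₂ : ∀ j, |(v₂ ᵥ* biased μ D) j - (if j ∈ T then 1 else 0)| ≤ 2 / 150 := by
    intro j
    have h1 : |S / M * ∑ k, D k j| ≤ M * σ ^ 2 / 150 := by
      rw [abs_mul, abs_div, abs_of_pos hM']
      calc |S| / M * |∑ k, D k j| ≤ r * t / M * t :=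
            mul_le_mul (div_le_div_of_nonneg_right hSle hM'.le) (hcol j) (abs_nonneg _)
              (div_nonneg ((abs_nonneg _).trans hSle) hM'.le)
        _ = r * t ^ 2 / M := by ring
        _ ≤ (M ^ 2 * σ ^ 2 / 150) / M := div_le_div_of_nonneg_right htT hM'.le
        _ = M * σ ^ 2 / 150 := by field_simp
    have h2 := hgram j
    have e : (v₂ ᵥ* biased μ D) j - (if j ∈ T then 1 else 0) =
        ((∑ k, u k * D k j - if j ∈ T then M * σ ^ 2 else 0) - S / M * ∑ k, D k j) /
          (M * σ ^ 2) := by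
      rw [hw₂]
      split_ifs
      · field_simp
        ring
      · simp
    rw [e, abs_div, abs_of_pos hMs, div_le_iff₀ hMs]
    refine (abs_sub _ _).trans ?_
    linarith
  have hE₁ : ∀ j, |(v₁ ᵥ* biased μ D) j - (if j ∈ T then 0 else 1)| ≤ 1 / 50 := by
    intro j
    have h1 : |(∑ k, D k j) / (μ * M)| ≤ 1 / 150 := by
      rw [abs_div, abs_of_pos (mul_pos hμ hM'), div_le_iff₀ (mul_pos hμ hM')]
      linarith [hcol j]
    have h2 := abs_le.1 (hE₂ j)
    have h3 := abs_le.1 h1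
    rw [hw₁, abs_le]
    split_ifs at h2 ⊢ <;> constructor <;> linarith
  have hn₂ : l2norm v₂ ^ 2 ≤ 151 / 150 * r / (M * σ ^ 2) := by
    rw [l2norm_sq]
    have h1 : ∑ k, (u k - S / M) ^ 2 ≤ ∑ k, u k ^ 2 := by
      have e : ∑ k, (u k - S / M) ^ 2 = ∑ k, u k ^ 2 - S ^ 2 / M := by
        have : ∀ k, (u k - S / M) ^ 2 = u k ^ 2 - 2 * (S / M) * u k + (S / M) ^ 2 :=
          fun k => by ring
        simp only [this, Finset.sum_add_distrib, Finset.sum_sub_distrib, hone, ← Finset.mul_sum]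
        rw [← hS]
        field_simp
        ring
      rw [e]
      have : 0 ≤ S ^ 2 / M := by positivity
      linarith
    simp only [hv₂, div_pow, ← Finset.sum_div]
    rw [div_le_div_iff₀ (by positivity) hMs]
    nlinarith
  have hn₁ : l2norm v₁ ^ 2 = 1 / (μ ^ 2 * M) + l2norm v₂ ^ 2 := by
    rw [l2norm_sq, l2norm_sq]
    have : ∀ k, v₁ k ^ 2 = (1 / (μ * M)) ^ 2 - 2 * (1 / (μ * M)) * v₂ k + v₂ k ^ 2 :=
      fun k => by simp only [hv₁]; ring
    simp only [this, Finset.sum_add_distrib, Finset.sum_sub_distrib, hone, ← Finset.mul_sum]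
    rw [hv₂sum]
    field_simp
    ring
  have key := l2norm_sq_le_of_certificates (biased μ D) T v₁ v₂ (δ := 1 / 50) (by norm_num)
    (by norm_num) hE₁ (fun j => (hE₂ j).trans (by norm_num)) hT hTc
  refine abs_le_of_sq_le_sq' ?_ (mul_nonneg (Real.sqrt_nonneg _) (l2norm_nonneg _)) |>.2
  rw [mul_pow, mul_pow, Real.sq_sqrt (by positivity)]
  have e : 9 * (16 * σ ^ 2 / μ ^ 2 + r) / (M * σ ^ 2) =
      9 * (16 * (1 / (μ ^ 2 * M)) + r / (M * σ ^ 2)) := by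
    field_simp
  rw [e]
  have hq : 0 ≤ r / (M * σ ^ 2) := by positivity
  have hp : 0 ≤ 1 / (μ ^ 2 * M) := by positivity
  rw [show 151 / 150 * r / (M * σ ^ 2) = 151 / 150 * (r / (M * σ ^ 2)) by ring] at hn₂
  generalize r / (M * σ ^ 2) = q at *
  generalize 1 / (μ ^ 2 * M) = p at *
  have hA : (l2norm v₁ ^ 2 + l2norm v₂ ^ 2) * l2norm (biased μ D *ᵥ h) ^ 2 ≤
      (p + 151 / 75 * q) * l2norm (biased μ D *ᵥ h) ^ 2 :=
    mul_le_mul_of_nonneg_right (by linarith) (sq_nonneg _)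
  -- The coefficient of q is the tight one: 4·151/75 ≈ 8.05 against 9·(24/25)² ≈ 8.29.
  have hB : 4 * (p + 151 / 75 * q) * l2norm (biased μ D *ᵥ h) ^ 2 ≤
      (1 - 2 * (1 / 50)) ^ 2 * (9 * (16 * p + q)) * l2norm (biased μ D *ᵥ h) ^ 2 :=
    mul_le_mul_of_nonneg_right (by norm_num; linarith) (sq_nonneg _)
  norm_num at key hA hB ⊢
  linarith

end Certificates

/-! ### Tail bounds for column sums and Gram entries. -/

section Concentration

variable {Ω : Type*} [MeasurableSpace Ω] {P : Measure Ω}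

/-- Chernoff's bound for the absolute value. -/
lemma measure_lt_abs_le {Y : Ω → ℝ} (hY : Measurable Y) {θ t b : ℝ} (hθ : 0 < θ)
    (h₁ : ∫⁻ ω, ENNReal.ofReal (Real.exp (θ * Y ω)) ∂P ≤ ENNReal.ofReal (Real.exp b))
    (h₂ : ∫⁻ ω, ENNReal.ofReal (Real.exp (-θ * Y ω)) ∂P ≤ ENNReal.ofReal (Real.exp b)) :
    P {ω | t < |Y ω|} ≤ ENNReal.ofReal (2 * Real.exp (b - θ * t)) := by
  have one : ∀ η : ℝ, ∫⁻ ω, ENNReal.ofReal (Real.exp (η * Y ω)) ∂P ≤ ENNReal.ofReal (Real.exp b) →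
      P {ω | θ * t ≤ η * Y ω} ≤ ENNReal.ofReal (Real.exp (b - θ * t)) := by
    intro η hη
    have h := (mul_meas_ge_le_lintegral (μ := P)
      (f := fun ω => ENNReal.ofReal (Real.exp (η * Y ω))) (by fun_prop)
      (ENNReal.ofReal (Real.exp (θ * t)))).trans hη
    rw [Real.exp_sub, ENNReal.ofReal_div_of_pos (Real.exp_pos _),
      ENNReal.le_div_iff_mul_le (Or.inl (by simpa using Real.exp_pos _))
        (Or.inl ENNReal.ofReal_ne_top), mul_comm]
    refine le_trans (mul_le_mul_right (measure_mono fun ω hω => ?_) _) h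
    exact ENNReal.ofReal_le_ofReal (Real.exp_le_exp.2 hω)
  calc P {ω | t < |Y ω|} ≤ P ({ω | θ * t ≤ θ * Y ω} ∪ {ω | θ * t ≤ -θ * Y ω}) := by
        refine measure_mono fun ω hω => ?_
        rcases lt_abs.1 (show t < |Y ω| from hω) with h | h
        · exact Or.inl (show θ * t ≤ θ * Y ω by nlinarith)
        · exact Or.inr (show θ * t ≤ -θ * Y ω by nlinarith)
    _ ≤ _ := (measure_union_le _ _).trans (add_le_add (one _ h₁) (one _ h₂))
    _ = _ := by rw [← ENNReal.ofReal_add (Real.exp_pos _).le (Real.exp_pos _).le, ← two_mul]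

section SubGaussianVector

variable {ι κ n : Type*} [Fintype κ] {X : ι → Ω → ℝ} {σ R : ℝ}

lemma IsSubGaussianVector.norm_le (hX : IsSubGaussianVector P σ R X) (i : ι) :
    subGaussianNorm P (X i) ≤ ENNReal.ofReal R :=
  (le_iSup (fun i => subGaussianNorm P (X i)) i).trans_eq hX.norm_eq

variable [IsProbabilityMeasure P]

lemma IsSubGaussianVector.pos [Nonempty ι] (hX : IsSubGaussianVector P σ R X) (hσ : 0 < σ) :
    0 < R := by
  by_contra! hR
  obtain ⟨i⟩ := ‹Nonempty ι›
  have h := hX.norm_le i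
  rw [ENNReal.ofReal_of_nonpos hR, ← ENNReal.ofReal_zero] at h
  have := second_moment_le (hX.measurable i) le_rfl h (hX.second_moment i)
  nlinarith

lemma IsSubGaussianVector.sq_le [Nonempty ι] (hX : IsSubGaussianVector P σ R X) (hσ : 0 < σ) :
    σ ^ 2 ≤ 2 * R ^ 2 := by
  have hR := (hX.pos hσ).le
  obtain ⟨i⟩ := ‹Nonempty ι›
  exact second_moment_le (hX.measurable i) hR (hX.norm_le i) (hX.second_moment i)

lemma IsSubGaussianVector.lintegral_exp_le (hX : IsSubGaussianVector P σ R X) (hR : 0 < R)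
    (i : ι) (t : ℝ) :
    ∫⁻ ω, ENNReal.ofReal (Real.exp (t * X i ω)) ∂P ≤
      ENNReal.ofReal (Real.exp (36 * R ^ 2 * t ^ 2)) :=
  lintegral_exp_mul_le (hX.measurable i) hR (hX.norm_le i) (hX.mean_eq_zero i) t

/-- Concentration of the column sums. -/
lemma measure_colSum_le (hX : IsSubGaussianVector P σ R X) (hR : 0 < R)
    {φ : κ → n → ι} (hcol : ∀ j, Function.Injective fun k => φ k j) (hκ : 0 < Fintype.card κ)
    (j : n) {t : ℝ} (ht : 0 < t) :
    P {ω | t < |∑ k, X (φ k j) ω|} ≤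
      ENNReal.ofReal (2 * Real.exp (-(t ^ 2 / (144 * R ^ 2 * Fintype.card κ)))) := by
  have hM : (0 : ℝ) < Fintype.card κ := by exact_mod_cast hκ
  -- Minimiser of 36R²Mθ² - θt.
  set θ := t / (72 * R ^ 2 * Fintype.card κ) with hθ
  have hθ0 : 0 < θ := by positivity
  have hmgf : ∀ η : ℝ, η ^ 2 = θ ^ 2 →
      ∫⁻ ω, ENNReal.ofReal (Real.exp (η * ∑ k, X (φ k j) ω)) ∂P ≤
      ENNReal.ofReal (Real.exp (36 * R ^ 2 * (Fintype.card κ * θ ^ 2))) := by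
    intro η hη
    have := lintegral_exp_linear_le (X := fun k => X (φ k j)) (fun k => hX.measurable _)
      (hX.indep.precomp (hcol j)) (fun k => hX.lintegral_exp_le hR (φ k j)) fun _ => η
    simpa [← Finset.mul_sum, hη] using this
  refine (measure_lt_abs_le (Finset.measurable_sum _ fun k _ => hX.measurable _) hθ0 (hmgf θ rfl)
    (hmgf (-θ) (by ring))).trans_eq ?_
  congr 3
  rw [hθ]
  field_simp
  ring

end SubGaussianVector

variable {ι κ n : Type*} [DecidableEq ι] [Fintype κ] [DecidableEq n]

/-- The coefficients of the off-diagonal part of an entry of `Dᵀ D χ_T` for a matrix `D` with the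
pattern `φ`. -/
def crossMatrix (φ : κ → n → ι) (T : Finset n) (j : n) : Matrix ι ι ℝ :=
  Matrix.of fun l l' => ∑ k, ∑ i ∈ T.erase j, if φ k j = l ∧ φ k i = l' then 1 else 0

variable {φ : κ → n → ι} {T : Finset n}

lemma crossMatrix_apply (j : n) (l l' : ι) : crossMatrix φ T j l l' =
    ∑ k, ∑ i ∈ T.erase j, if φ k j = l ∧ φ k i = l' then 1 else 0 := rfl

lemma crossMatrix_nonneg (j : n) (l l' : ι) : 0 ≤ crossMatrix φ T j l l' :=
  Finset.sum_nonneg fun _ _ => Finset.sum_nonneg fun _ _ => by split_ifs <;> norm_num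

/-- Collecting the terms with equal pairs of variables identifies the off-diagonal part of a Gram
entry with a quadratic form. -/
lemma sum_crossMatrix_mul [Fintype ι] (j : n) (f : ι → ι → ℝ) :
    ∑ l, ∑ l', crossMatrix φ T j l l' * f l l' = ∑ k, ∑ i ∈ T.erase j, f (φ k j) (φ k i) := by
  have h1 : ∀ l, ∑ l', crossMatrix φ T j l l' * f l l' =
      ∑ k, ∑ i ∈ T.erase j, if φ k j = l then f l (φ k i) else 0 := by
    intro l
    simp only [crossMatrix_apply, Finset.sum_mul]
    rw [Finset.sum_comm]
    refine Finset.sum_congr rfl fun k _ => ?_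
    rw [Finset.sum_comm]
    refine Finset.sum_congr rfl fun i _ => ?_
    by_cases h : φ k j = l <;> simp [h]
  simp only [h1]
  rw [Finset.sum_comm]
  refine Finset.sum_congr rfl fun k _ => ?_
  rw [Finset.sum_comm]
  refine Finset.sum_congr rfl fun i _ => ?_
  simp

/-- No square occurs, since two distinct columns carry different variables in each row. -/
lemma crossMatrix_diag (hrow : ∀ k, Function.Injective (φ k)) (j : n) (l : ι) :
    crossMatrix φ T j l l = 0 := by
  refine Finset.sum_eq_zero fun k _ => Finset.sum_eq_zero fun i hi => if_neg fun h => ?_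
  exact (Finset.mem_erase.1 hi).1 (hrow k (h.2.trans h.1.symm))

omit [DecidableEq n] in
lemma sum_ite_eq_le_one (hcol : ∀ j, Function.Injective fun k => φ k j) (i : n) (l : ι) :
    ∑ k, (if φ k i = l then (1 : ℝ) else 0) ≤ 1 := by
  classical
  rw [Finset.sum_boole]
  have : (Finset.univ.filter fun k => φ k i = l).card ≤ 1 := by
    refine Finset.card_le_one.2 fun a ha b hb => hcol i ?_
    simp only [Finset.mem_filter, Finset.mem_univ, true_and] at ha hb
    exact ha.trans hb.symm
  exact_mod_cast this

lemma card_erase_le_real (j : n) : ((T.erase j).card : ℝ) ≤ T.card := by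
  exact_mod_cast Finset.card_erase_le

/-- The variable l stands in at most one row of column j, and that row contributes at most |T|
partners. -/
lemma crossMatrix_row_le [Fintype ι] (hcol : ∀ j, Function.Injective fun k => φ k j) (j : n) (l : ι) :
    ∑ l', crossMatrix φ T j l l' ≤ T.card := by
  have e : ∑ l', crossMatrix φ T j l l' =
      (T.erase j).card * ∑ k, if φ k j = l then (1 : ℝ) else 0 := by
    simp only [crossMatrix_apply]
    rw [Finset.sum_comm, Finset.mul_sum]
    refine Finset.sum_congr rfl fun k _ => ?_
    rw [Finset.sum_comm]
    by_cases h : φ k j = l <;> simp [h]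
  rw [e]
  exact (mul_le_of_le_one_right (Nat.cast_nonneg _) (sum_ite_eq_le_one hcol j l)).trans
    (card_erase_le_real j)

/-- Each column in T contains l' at most once. -/
lemma crossMatrix_col_le [Fintype ι] (hcol : ∀ j, Function.Injective fun k => φ k j) (j : n) (l' : ι) :
    ∑ l, crossMatrix φ T j l l' ≤ T.card := by
  have e : ∑ l, crossMatrix φ T j l l' =
      ∑ i ∈ T.erase j, ∑ k, if φ k i = l' then (1 : ℝ) else 0 := by
    simp only [crossMatrix_apply]
    rw [Finset.sum_comm, Finset.sum_comm (s := T.erase j)]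
    refine Finset.sum_congr rfl fun k _ => ?_
    rw [Finset.sum_comm]
    refine Finset.sum_congr rfl fun i _ => ?_
    by_cases h : φ k i = l' <;> simp [h]
  rw [e]
  refine (Finset.sum_le_sum fun i _ => sum_ite_eq_le_one hcol i l').trans ?_
  rw [Finset.sum_const, nsmul_eq_mul, mul_one]
  exact card_erase_le_real j

/-- In column j the variable l determines the row, in which l' determines the column. -/
lemma crossMatrix_le_one (hrow : ∀ k, Function.Injective (φ k))
    (hcol : ∀ j, Function.Injective fun k => φ k j) (j : n) (l l' : ι) :
    crossMatrix φ T j l l' ≤ 1 := by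
  refine le_trans (Finset.sum_le_sum fun k _ => ?_) (sum_ite_eq_le_one hcol j l)
  by_cases h : φ k j = l
  · simp only [h, true_and, if_true]
    rw [Finset.sum_boole]
    have : ((T.erase j).filter fun i => φ k i = l').card ≤ 1 := by
      refine Finset.card_le_one.2 fun a ha b hb => hrow k ?_
      exact (Finset.mem_filter.1 ha).2.trans (Finset.mem_filter.1 hb).2.symm
    exact_mod_cast this
  · simp [h]

/-- With coefficients in [0,1], squares are dominated by the coefficients, whose total counts the
pairs (k, i). -/
lemma sum_sq_crossMatrix_le [Fintype ι] (hrow : ∀ k, Function.Injective (φ k))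
    (hcol : ∀ j, Function.Injective fun k => φ k j) (j : n) :
    ∑ l, ∑ l', crossMatrix φ T j l l' ^ 2 ≤ Fintype.card κ * T.card := by
  calc ∑ l, ∑ l', crossMatrix φ T j l l' ^ 2 ≤ ∑ l, ∑ l', crossMatrix φ T j l l' * 1 := by
        refine Finset.sum_le_sum fun l _ => Finset.sum_le_sum fun l' _ => ?_
        rw [sq]
        exact mul_le_mul_of_nonneg_left (crossMatrix_le_one hrow hcol j l l')
          (crossMatrix_nonneg j l l')
    _ = Fintype.card κ * (T.erase j).card := by
        rw [sum_crossMatrix_mul j fun _ _ => 1]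
        simp
    _ ≤ _ := mul_le_mul_of_nonneg_left (card_erase_le_real j) (Nat.cast_nonneg _)

/-- Concentration of the entries of `Dᵀ D χ_T` for a matrix `D` with the pattern `φ`. -/
lemma measure_gram_le [Fintype ι] [IsProbabilityMeasure P] {X : ι → Ω → ℝ} {σ R : ℝ}
    (hX : IsSubGaussianVector P σ R X) (hσ : 0 < σ) (hR : 0 < R)
    (hσR : σ ^ 2 ≤ 2 * R ^ 2) (hrow : ∀ k, Function.Injective (φ k))
    (hcol : ∀ j, Function.Injective fun k => φ k j) (hT : T.Nonempty) (j : n) :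
    P {ω | Fintype.card κ * σ ^ 2 / 150 < |∑ k, ∑ i ∈ T, X (φ k j) ω * X (φ k i) ω -
        (if j ∈ T then Fintype.card κ * σ ^ 2 else 0)|} ≤
      ENNReal.ofReal (4 * Real.exp (-(Fintype.card κ * σ ^ 4 /
        (22500 * 1024 * 1296 * R ^ 4 * T.card)))) := by
  set M : ℝ := (Fintype.card κ : ℝ) with hM
  have hM0 : 0 ≤ M := Nat.cast_nonneg _
  have hr1 : (1 : ℝ) ≤ T.card := by exact_mod_cast hT.card_pos
  set r : ℝ := (T.card : ℝ) with hr
  have hr0 : 0 < r := by linarith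
  -- Minimiser of b - θMσ²/300; the tolerance Mσ²/150 is split equally between off-diagonal and
  -- diagonal part.
  set θ : ℝ := σ ^ 2 / (150 * 256 * (36 * R ^ 2) ^ 2 * r) with hθ
  have hθ0 : 0 < θ := by positivity
  set b : ℝ := 64 * (36 * R ^ 2) ^ 2 * θ ^ 2 * (M * r) with hb
  -- Because σ² ≤ 2R², the optimal θ lies in the admissible range, so no separate subexponential
  -- regime arises.
  have hθr : θ * (36 * R ^ 2) * r ≤ 1 / 100000 := by
    have e : θ * (36 * R ^ 2) * r = σ ^ 2 / (150 * 256 * (36 * R ^ 2)) := by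
      rw [hθ]; field_simp
    rw [e, div_le_iff₀ (by positivity)]
    nlinarith
  set Y : Ω → ℝ := fun ω => ∑ k, ∑ i ∈ T.erase j, X (φ k j) ω * X (φ k i) ω with hY
  set Z : Ω → ℝ := fun ω => ∑ k, (X (φ k j) ω ^ 2 - σ ^ 2) with hZ
  have hXm := hX.measurable
  have hYm : Measurable Y := by simp only [hY]; fun_prop
  have hZm : Measurable Z := by simp only [hZ]; fun_prop
  have hYmgf : ∀ η : ℝ, η ^ 2 = θ ^ 2 → ∫⁻ ω, ENNReal.ofReal (Real.exp (η * Y ω)) ∂P ≤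
      ENNReal.ofReal (Real.exp b) := by
    intro η hη
    have h1 := lintegral_exp_quadratic_le hXm hX.indep (by positivity) (hX.lintegral_exp_le hR)
      (crossMatrix φ T j) (r := r) (θ := η) (crossMatrix_nonneg j) (crossMatrix_diag hrow j)
      (crossMatrix_row_le hcol j) (crossMatrix_col_le hcol j) (by
        rw [hη, show 128 * (36 * R ^ 2) ^ 2 * θ ^ 2 * r ^ 2 = 128 * (θ * (36 * R ^ 2) * r) ^ 2 by
          ring]
        have h0 : 0 ≤ θ * (36 * R ^ 2) * r := by positivity
        nlinarith)
    have h2 : ∀ ω, ∑ l, ∑ l', crossMatrix φ T j l l' * X l ω * X l' ω = Y ω := by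
      intro ω
      simp only [mul_assoc]
      exact sum_crossMatrix_mul j fun l l' => X l ω * X l' ω
    simp only [h2] at h1
    refine h1.trans (ENNReal.ofReal_le_ofReal (Real.exp_le_exp.2 ?_))
    rw [hη]
    exact mul_le_mul_of_nonneg_left (sum_sq_crossMatrix_le hrow hcol j) (by positivity)
  -- The diagonal part satisfies the same bound b, as r ≥ 1.
  have hZmgf : ∀ η : ℝ, |η| = θ → ∫⁻ ω, ENNReal.ofReal (Real.exp (η * Z ω)) ∂P ≤
      ENNReal.ofReal (Real.exp b) := by
    intro η hη
    have h1 := lintegral_exp_sum_le (X := fun k => X (φ k j)) (fun k => hXm _)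
      (hX.indep.precomp (hcol j)) (f := fun _ x => η * (x ^ 2 - σ ^ 2)) (fun k => by fun_prop)
      (b := fun _ => 432 * R ^ 4 * η ^ 2) fun k =>
        lintegral_exp_mul_sq_sub_le (hXm _) hR (hX.norm_le _) (hX.second_moment _) (by
          rw [hη]
          have h0 : 0 ≤ θ * (36 * R ^ 2) := by positivity
          nlinarith [mul_le_mul_of_nonneg_left hr1 h0])
    rw [Finset.sum_const, Finset.card_univ, nsmul_eq_mul, ← sq_abs η, hη] at h1
    simp only [hZ, Finset.mul_sum]
    refine h1.trans (ENNReal.ofReal_le_ofReal (Real.exp_le_exp.2 ?_))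
    rw [hb, ← hM]
    have h0 : 0 ≤ M * (R ^ 4 * θ ^ 2) := by positivity
    nlinarith [mul_le_mul_of_nonneg_left hr1 h0]
  have habs : |θ| = θ := abs_of_pos hθ0
  have hPY := measure_lt_abs_le (t := M * σ ^ 2 / 300) hYm hθ0 (hYmgf θ rfl)
    (hYmgf (-θ) (by ring))
  have hPZ := measure_lt_abs_le (t := M * σ ^ 2 / 300) hZm hθ0 (hZmgf θ habs)
    (hZmgf (-θ) (by rw [abs_neg, habs]))
  have hexp : b - θ * (M * σ ^ 2 / 300) =
      -(M * σ ^ 4 / (22500 * 1024 * 1296 * R ^ 4 * r)) := by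
    rw [hb, hθ]
    field_simp
    ring
  rw [hexp] at hPY hPZ
  have hdec : ∀ ω, ∑ k, ∑ i ∈ T, X (φ k j) ω * X (φ k i) ω -
      (if j ∈ T then M * σ ^ 2 else 0) = Y ω + if j ∈ T then Z ω else 0 := by
    intro ω
    split_ifs with hj
    · have h1 : ∀ k, ∑ i ∈ T, X (φ k j) ω * X (φ k i) ω =
          ∑ i ∈ T.erase j, X (φ k j) ω * X (φ k i) ω + X (φ k j) ω ^ 2 := fun k => by
        rw [← Finset.sum_erase_add _ _ hj, sq]
      simp only [h1, hY, hZ, Finset.sum_add_distrib, Finset.sum_sub_distrib, Finset.sum_const,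
        Finset.card_univ, nsmul_eq_mul]
      ring
    · simp only [hY, Finset.erase_eq_of_notMem hj]
      ring
  calc _ ≤ P ({ω | M * σ ^ 2 / 300 < |Y ω|} ∪ {ω | M * σ ^ 2 / 300 < |Z ω|}) := by
        refine measure_mono fun ω hω => ?_
        have hω' : M * σ ^ 2 / 150 < |Y ω + if j ∈ T then Z ω else 0| := by
          rw [← hdec]; exact hω
        by_contra hcon
        have h1 : |Y ω| ≤ M * σ ^ 2 / 300 := not_lt.1 fun h => hcon (Or.inl h)
        have h2 : |Z ω| ≤ M * σ ^ 2 / 300 := not_lt.1 fun h => hcon (Or.inr h)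
        have h3 := abs_add_le (Y ω) (if j ∈ T then Z ω else 0)
        have h4 : |if j ∈ T then Z ω else 0| ≤ M * σ ^ 2 / 300 := by
          split_ifs
          · exact h2
          · rw [abs_zero]; positivity
        linarith
    _ ≤ _ := (measure_union_le _ _).trans (add_le_add hPY hPZ)
    _ = _ := by
        rw [← ENNReal.ofReal_add (by positivity) (by positivity)]
        congr 1
        ring

end Concentration

/-! ### The union bound and recovery with high probability. -/

section Recovery

variable {Ω : Type*} [MeasurableSpace Ω] {P : Measure Ω} [IsProbabilityMeasure P]
  {ι κ n : Type*} [Fintype ι] [DecidableEq ι] [Fintype κ] [Fintype n] [DecidableEq n]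

/-- Exact and robust recovery of binary vectors with overwhelming probability, for biased random
matrices whose entries are repeated neither within a row nor within a column. -/
theorem lt_measureReal_recovery {X : ι → Ω → ℝ} {σ R μ ε : ℝ} (hX : IsSubGaussianVector P σ R X)
    (hμ : 0 < μ) (hσ : 0 < σ) (hε : 0 < ε) {φ : κ → n → ι}
    (hrow : ∀ k, Function.Injective (φ k)) (hcol : ∀ j, Function.Injective fun k => φ k j)
    (hκ : 0 < Fintype.card κ) (hn : 2 ≤ Fintype.card n) {x₀ : n → ℝ}
    (hx₀ : ∀ i, x₀ i = 0 ∨ x₀ i = 1) (T : Finset n)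
    (hT : (∀ j, x₀ j = 1 ↔ j ∈ T) ∨ ∀ j, x₀ j = 1 ↔ j ∉ T)
    (hM : 10 ^ 12 * (max (R ^ 2 / μ ^ 2) (T.card * (2 * R ^ 4 / σ ^ 4)) *
      Real.log (Fintype.card n / ε)) ≤ Fintype.card κ) :
    1 - ε < P.real {ω |
      ExactRecovery (biased μ (Matrix.of fun k j => X (φ k j) ω)) x₀ ∧
      RobustRecovery (biased μ (Matrix.of fun k j => X (φ k j) ω)) x₀
        (recoveryConstant μ σ T.card (Fintype.card κ))} := by
  rcases lt_or_ge 1 ε with hε1 | hε1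
  · exact (by linarith : 1 - ε < 0).trans_le measureReal_nonneg
  have hM0 : (0 : ℝ) < Fintype.card κ := by exact_mod_cast hκ
  have hN2 : (2 : ℝ) ≤ Fintype.card n := by exact_mod_cast hn
  have : Nonempty ι := by
    obtain ⟨k⟩ := Fintype.card_pos_iff.1 hκ
    obtain ⟨j⟩ := Fintype.card_pos_iff.1 (by omega : 0 < Fintype.card n)
    exact ⟨φ k j⟩
  have hR := hX.pos hσ
  have hσR := hX.sq_le hσ
  set M : ℝ := (Fintype.card κ : ℝ) with hMdef
  set N : ℝ := (Fintype.card n : ℝ) with hNdef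
  set r : ℝ := (T.card : ℝ) with hr
  have hr0 : 0 ≤ r := Nat.cast_nonneg _
  have hNε : 2 ≤ N / ε := by
    rw [le_div_iff₀ hε]
    nlinarith
  have hNε0 : 0 < N / ε := by linarith
  set L := Real.log (N / ε) with hL
  have hL0 : 0 < L := Real.log_pos (by linarith)
  have hM₁ : 10 ^ 12 * (R ^ 2 / μ ^ 2 * L) ≤ M :=
    (mul_le_mul_of_nonneg_left (mul_le_mul_of_nonneg_right (le_max_left _ _) hL0.le)
      (by positivity)).trans hM
  have hM₂ : 10 ^ 12 * (r * (2 * R ^ 4 / σ ^ 4) * L) ≤ M :=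
    (mul_le_mul_of_nonneg_left (mul_le_mul_of_nonneg_right (le_max_right _ _) hL0.le)
      (by positivity)).trans hM
  -- 720 = 5·144 makes the column-sum tail 2(ε/N)⁵.
  set t : ℝ := Real.sqrt (720 * R ^ 2 * M * L) with ht
  have ht2 : t ^ 2 = 720 * R ^ 2 * M * L := Real.sq_sqrt (by positivity)
  have ht0 : 0 < t := Real.sqrt_pos.2 (by positivity)
  have htμ : t ≤ μ * M / 150 := by
    refine Real.sqrt_le_iff.2 ⟨by positivity, ?_⟩
    have h1 : 10 ^ 12 * (R ^ 2 * L) ≤ M * μ ^ 2 := by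
      have := mul_le_mul_of_nonneg_right hM₁ (sq_nonneg μ)
      rwa [show 10 ^ 12 * (R ^ 2 / μ ^ 2 * L) * μ ^ 2 = 10 ^ 12 * (R ^ 2 * L) by field_simp] at this
    have h2 := mul_le_mul_of_nonneg_right h1 hM0.le
    have h3 : 0 ≤ R ^ 2 * L * M := by positivity
    nlinarith
  have hσ4 : 0 < σ ^ 4 := by positivity
  have h4 : 10 ^ 12 * (r * (2 * R ^ 4) * L) ≤ M * σ ^ 4 := by
    have := mul_le_mul_of_nonneg_right hM₂ hσ4.le
    rwa [show 10 ^ 12 * (r * (2 * R ^ 4 / σ ^ 4) * L) * σ ^ 4 =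
      10 ^ 12 * (r * (2 * R ^ 4) * L) by field_simp] at this
  have htT : r * t ^ 2 ≤ M ^ 2 * σ ^ 2 / 150 := by
    rw [ht2]
    -- σ² ≤ 2R² trades one factor R²/σ² of the second sample condition.
    have h5 : 10 ^ 12 * (r * R ^ 2 * L) ≤ M * σ ^ 2 := by
      refine le_of_mul_le_mul_right ?_ (by positivity : 0 < σ ^ 2)
      calc 10 ^ 12 * (r * R ^ 2 * L) * σ ^ 2 ≤ 10 ^ 12 * (r * R ^ 2 * L) * (2 * R ^ 2) :=
            mul_le_mul_of_nonneg_left hσR (by positivity)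
        _ = 10 ^ 12 * (r * (2 * R ^ 4) * L) := by ring
        _ ≤ M * σ ^ 4 := h4
        _ = M * σ ^ 2 * σ ^ 2 := by ring
    have h6 := mul_le_mul_of_nonneg_right h5 hM0.le
    have h7 : 0 ≤ r * R ^ 2 * L * M := by positivity
    nlinarith
  set D : Ω → Matrix κ n ℝ := fun ω => Matrix.of fun k j => X (φ k j) ω with hD
  set E₁ : n → Set Ω := fun j => {ω | t < |∑ k, X (φ k j) ω|} with hE₁
  set E₂ : n → Set Ω := fun j => {ω | M * σ ^ 2 / 150 <
    |∑ k, ∑ i ∈ T, X (φ k j) ω * X (φ k i) ω - (if j ∈ T then M * σ ^ 2 else 0)|} with hE₂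
  have hXm := hX.measurable
  have hE₁m : ∀ j, MeasurableSet (E₁ j) := fun j =>
    measurableSet_lt measurable_const (by fun_prop)
  have hE₂m : ∀ j, MeasurableSet (E₂ j) := fun j =>
    measurableSet_lt measurable_const (by fun_prop)
  have hP₁ : ∀ j, P (E₁ j) ≤ ENNReal.ofReal (2 * Real.exp (-(5 * L))) := by
    intro j
    refine (measure_colSum_le hX hR hcol hκ j ht0).trans_eq ?_
    rw [ht2, ← hMdef]
    congr 4
    field_simp
    norm_num
  have hP₂ : ∀ j, P (E₂ j) ≤ ENNReal.ofReal (4 * Real.exp (-(5 * L))) := by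
    intro j
    -- The Gram tail divides by |T|; for empty T the bad event is itself empty.
    rcases T.eq_empty_or_nonempty with rfl | hTne
    · have : E₂ j = ∅ := by
        ext ω
        simp only [hE₂, Finset.sum_empty, Finset.sum_const_zero, Finset.notMem_empty, if_false,
          sub_zero, abs_zero, Set.mem_ofPred_eq, Set.mem_empty_iff_false, iff_false, not_lt]
        positivity
      rw [this, measure_empty]
      exact zero_le
    · refine (measure_gram_le hX hσ hR hσR hrow hcol hTne j).trans
        (ENNReal.ofReal_le_ofReal (mul_le_mul_of_nonneg_left (Real.exp_le_exp.2 ?_) (by norm_num)))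
      have hrpos : 0 < r := by rw [hr]; exact_mod_cast hTne.card_pos
      rw [neg_le_neg_iff, le_div_iff₀ (by positivity)]
      have : 0 ≤ r * R ^ 4 * L := by positivity
      nlinarith
  set bad : Set Ω := ⋃ j, (E₁ j ∪ E₂ j) with hbad
  have hbadm : MeasurableSet bad := MeasurableSet.iUnion fun j => (hE₁m j).union (hE₂m j)
  have hexp : Real.exp (-(5 * L)) = (ε / N) ^ 5 := by
    rw [show -(5 * L) = ((5 : ℕ) : ℝ) * -L by push_cast; ring, Real.exp_nat_mul, Real.exp_neg, hL,
      Real.exp_log hNε0, inv_div]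
  have hPbad : P.real bad ≤ N * (6 * (ε / N) ^ 5) := by
    refine ENNReal.toReal_le_of_le_ofReal (by positivity) ?_
    calc P bad ≤ ∑ j, P (E₁ j ∪ E₂ j) := measure_iUnion_fintype_le _ _
      _ ≤ ∑ _j : n, ENNReal.ofReal (6 * (ε / N) ^ 5) := by
          refine Finset.sum_le_sum fun j _ => (measure_union_le _ _).trans ?_
          refine (add_le_add (hP₁ j) (hP₂ j)).trans_eq ?_
          rw [← ENNReal.ofReal_add (by positivity) (by positivity), hexp]
          congr 1
          ring
      _ = _ := by
          rw [Finset.sum_const, Finset.card_univ, nsmul_eq_mul,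
            ENNReal.ofReal_mul (p := N) (by linarith), hNdef, ENNReal.ofReal_natCast]
  -- Since N/ε ≥ 2, the left side 6ε(ε/N)⁴ is at most 6ε/16.
  have hlt : N * (6 * (ε / N) ^ 5) < ε := by
    have hN0 : 0 < N := by linarith
    have h1 : ε / N ≤ 1 / 2 := by
      rw [div_le_iff₀ hN0]
      linarith
    have h2 : (ε / N) ^ 4 ≤ (1 / 2) ^ 4 := pow_le_pow_left₀ (by positivity) h1 4
    have e : N * (6 * (ε / N) ^ 5) = 6 * ε * (ε / N) ^ 4 := by field_simp
    rw [e]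
    nlinarith
  have hgood : badᶜ ⊆ {ω | ExactRecovery (biased μ (D ω)) x₀ ∧
      RobustRecovery (biased μ (D ω)) x₀ (recoveryConstant μ σ r M)} := by
    intro ω hω
    simp only [hbad, Set.mem_compl_iff, Set.mem_iUnion, Set.mem_union, not_exists, not_or] at hω
    have hcone : ∀ h : n → ℝ, (∀ j ∈ T, h j ≤ 0) → (∀ j ∉ T, 0 ≤ h j) →
        2 * l2norm h ≤ recoveryConstant μ σ r M * l2norm (biased μ (D ω) *ᵥ h) :=
      fun h => cone_bound_of_gram (D ω) T hμ hσ hκ (fun j => not_lt.1 (hω j).1) htμ htT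
        fun j => not_lt.1 (hω j).2
    refine recovery_of_cone_bound _ hx₀ (Real.sqrt_nonneg _) fun h h1 h0 => ?_
    have hzero : ∀ j, x₀ j ≠ 1 → x₀ j = 0 := fun j hj => (hx₀ j).resolve_right hj
    rcases hT with hT | hT
    · exact hcone h (fun j hj => h1 j ((hT j).2 hj)) fun j hj => h0 j (hzero j fun e => hj ((hT j).1 e))
    -- When T is the zero set of x₀ the signs are reversed, so the cone bound is applied to -h.
    · have := hcone (-h) (fun j hj => neg_nonpos.2 (h0 j (hzero j fun e => (hT j).1 e hj)))
        fun j hj => neg_nonneg.2 (h1 j ((hT j).2 hj))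
      rwa [Matrix.mulVec_neg, ← zero_sub h, ← zero_sub (biased μ (D ω) *ᵥ h), l2norm_sub_comm,
        l2norm_sub_comm 0, sub_zero, sub_zero] at this
  calc 1 - ε < 1 - P.real bad := by linarith
    _ = P.real badᶜ := by rw [probReal_compl_eq_one_sub hbadm]
    _ ≤ _ := measureReal_mono hgood

omit [DecidableEq n] in
/-- A binary vector is described by its support or by its zero set, whichever is smaller. -/
lemma exists_finset_of_binary {x₀ : n → ℝ} (hx₀ : ∀ i, x₀ i = 0 ∨ x₀ i = 1) :
    ∃ T : Finset n, ((∀ j, x₀ j = 1 ↔ j ∈ T) ∨ ∀ j, x₀ j = 1 ↔ j ∉ T) ∧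
      (T.card : ℝ) = min (hammingNorm x₀ : ℝ) (Fintype.card n - hammingNorm x₀) := by
  classical
  set S : Finset n := Finset.univ.filter fun j => x₀ j ≠ 0 with hS
  have hcard : hammingNorm x₀ = S.card := rfl
  have hmem : ∀ j, x₀ j = 1 ↔ j ∈ S := by
    intro j
    simp only [hS, Finset.mem_filter, Finset.mem_univ, true_and]
    rcases hx₀ j with h | h <;> simp [h]
  have hcompl : (Sᶜ.card : ℝ) = Fintype.card n - S.card := by
    rw [Finset.card_compl, Nat.cast_sub (Finset.card_le_univ S)]
  rw [hcard, ← hcompl]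
  rcases le_total (S.card : ℝ) (Sᶜ.card : ℝ) with h | h
  · exact ⟨S, Or.inl hmem, (min_eq_left h).symm⟩
  · exact ⟨Sᶜ, Or.inr fun j => by rw [hmem, Finset.mem_compl, not_not], (min_eq_right h).symm⟩

end Recovery

end BinaryRecovery

end

/-! ### Circulant and Toeplitz matrices as instances of the pattern. -/

theorem mainTheorem1 :
    ∃ C' : ℝ, 0 < C' ∧ ∀ μ σ : ℝ, 0 < μ → 0 < σ → ∃ C : ℝ, 0 < C ∧
      ∀ (Ω : Type*) [MeasurableSpace Ω] (P : Measure Ω) [IsProbabilityMeasure P]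
        (N M s : ℕ) (Θ : Finset (Fin N)) (x₀ : Fin N → ℝ) (R ε : ℝ),
        0 < M → M < N → Θ.card = M →
        (∀ i, x₀ i = 0 ∨ x₀ i = 1) → hammingNorm x₀ = s →
        0 < ε →
        C * (max (R ^ 2 / μ ^ 2) (min (s : ℝ) ((N : ℝ) - s) * (2 * R ^ 4 / σ ^ 4))
            * Real.log (N / ε)) ≤ M →
        -- biased partial random circulant matrices
        (∀ b : Fin N → Ω → ℝ, BinaryRecovery.IsSubGaussianVector P σ R b →
          1 - ε < P.real {ω | BinaryRecovery.ExactRecovery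
            (BinaryRecovery.biased μ
              (BinaryRecovery.rowsOf (BinaryRecovery.circulantMatrix fun i => b i ω) Θ)) x₀} ∧
          (C' * ((R / σ) ^ (4 / 3 : ℝ) * Real.log ε⁻¹) ≤ M →
            1 - ε < P.real {ω |
              BinaryRecovery.ExactRecovery (BinaryRecovery.biased μ
                (BinaryRecovery.rowsOf (BinaryRecovery.circulantMatrix fun i => b i ω) Θ)) x₀ ∧
              BinaryRecovery.RobustRecovery (BinaryRecovery.biased μ
                (BinaryRecovery.rowsOf (BinaryRecovery.circulantMatrix fun i => b i ω) Θ)) x₀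
                (Real.sqrt (9 * (16 * σ ^ 2 / μ ^ 2 + min (s : ℝ) ((N : ℝ) - s))
                  / (M * σ ^ 2)))})) ∧
        -- biased partial random Toeplitz matrices
        (∀ c : Set.Ioo (-(N : ℤ)) (N : ℤ) → Ω → ℝ, BinaryRecovery.IsSubGaussianVector P σ R c →
          1 - ε < P.real {ω | BinaryRecovery.ExactRecovery
            (BinaryRecovery.biased μ
              (BinaryRecovery.rowsOf (BinaryRecovery.toeplitzMatrix fun i => c i ω) Θ)) x₀} ∧
          (C' * ((R / σ) ^ (4 / 3 : ℝ) * Real.log ε⁻¹) ≤ M →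
            1 - ε < P.real {ω |
              BinaryRecovery.ExactRecovery (BinaryRecovery.biased μ
                (BinaryRecovery.rowsOf (BinaryRecovery.toeplitzMatrix fun i => c i ω) Θ)) x₀ ∧
              BinaryRecovery.RobustRecovery (BinaryRecovery.biased μ
                (BinaryRecovery.rowsOf (BinaryRecovery.toeplitzMatrix fun i => c i ω) Θ)) x₀
                (Real.sqrt (9 * (16 * σ ^ 2 / μ ^ 2 + min (s : ℝ) ((N : ℝ) - s))
                  / (M * σ ^ 2)))})) := by
  refine ⟨1, one_pos, fun μ σ hμ hσ => ⟨10 ^ 12, by positivity, ?_⟩⟩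
  intro Ω _ P _ N M s Θ x₀ R ε hM hMN hΘ hx₀ hs hε hC
  obtain ⟨T, hT, hTcard⟩ := BinaryRecovery.exists_finset_of_binary hx₀
  have hκ : Fintype.card Θ = M := by rw [Fintype.card_coe, hΘ]
  have hn : Fintype.card (Fin N) = N := Fintype.card_fin N
  rw [hs, hn] at hTcard
  rw [← hTcard, ← hκ] at hC
  have hcast : (M : ℝ) = Fintype.card Θ := by rw [hκ]
  rw [← hTcard, hcast]
  have hN : NeZero N := ⟨by omega⟩
  refine ⟨fun b hb => ?_, fun c hc => ?_⟩
  -- In both cases the pattern is j - k, injective in each argument separately; one event gives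
  -- exact and robust recovery together.
  · have key := BinaryRecovery.lt_measureReal_recovery hb hμ hσ hε
      (φ := fun (k : Θ) (j : Fin N) => j - (k : Fin N)) (fun k => sub_left_injective)
      (fun j => sub_right_injective.comp Subtype.val_injective) (by omega) (by omega) hx₀ T hT
      (by rwa [hn])
    exact ⟨key.trans_le (measureReal_mono fun ω hω => hω.1), fun _ => key⟩
  · have key := BinaryRecovery.lt_measureReal_recovery hc hμ hσ hε
      (φ := fun (k : Θ) (j : Fin N) => ⟨(j : ℤ) - ((k : Fin N) : ℤ), by
        have hj := j.isLt
        have hk := (k : Fin N).isLt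
        constructor <;> omega⟩)
      (fun k j j' h => Fin.ext (by
        have := congrArg Subtype.val h
        simp only at this
        omega))
      (fun j k k' h => Subtype.ext (Fin.ext (by
        have := congrArg Subtype.val h
        simp only at this
        omega))) (by omega) (by omega) hx₀ T hT (by rwa [hn])
    exact ⟨key.trans_le (measureReal_mono fun ω hω => hω.1), fun _ => key⟩
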